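/- Let $p\ge 0$, $\beta_0\in\mathbb R$ and $\beta_{1h},\beta_{2h}\in\mathbb R$ ($h=1,\dots,p$) satisfy $\sum_{h=1}^p(|\beta_{1h}|+|\beta_{2h}|)<1$. *Model.* Let the set of nodes $I$ be $\{1,\dots,N\}$ or $\{1,2,\dots\}$ ("$N\to\infty$"). Let $W=(w_{ij})_{i,j\in I}$ be a real matrix with $\sum_{j}|w_{ij}|\le 1$ for every $i$ (for instance the row-normalized adjacency matrix $w_{ij}=a_{ij}/n_i$ of a directed graph with finite out-degrees $n_i=\sum_j a_{ij}$). Let a copula on $I$ be given, that is, a probability measure on $\mathbb R^I$ whose one-dimensional marginals are uniform on $[0,1]$, and let $(U_{i,l,t})_{i\in I}$, $l\ge1$, $t\in\mathbb Z$, be independent random vectors with this law on a probability space. Put $N_{i,t}(\lambda)=\max\{k\ge0:\sum_{l=1}^k(-\log U_{i,l,t})\le\lambda\}$ for $\lambda\ge 0$; thus each $N_{i,t}$ is a Poisson process of rate one. A solution of the log-linear PNAR($p$) model is a process $Y_t=(Y_{i,t})_{i\in I}\in\{0,1,2,\dots\}^I$, $t\in\mathbb Z$, on this space such that, for every $t$,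 $(U_{i,l,t})_{i\in I,\,l\ge 1}$ is independent of $(Y_{i,s},U_{i,l,s})_{i\in I,\,l\ge1,\,s<t}$ and almost surely, for all $i\in I$, $$Y_{i,t}=N_{i,t}\bigl(e^{\nu_{i,t}}\bigr),\qquad \nu_{i,t}=\beta_0+\sum_{h=1}^p\beta_{1h}\sum_{j\in I}w_{ij}\log(1+Y_{j,t-h})+\sum_{h=1}^p\beta_{2h}\log(1+Y_{i,t-h}),$$ where the series over $j$ converge absolutely. *Stationarity.* For $I=\{1,\dots,N\}$, strictly stationary means that the law of $(Y_t)_{t\in\mathbb Z}$ is invariant under time shifts. For $I=\{1,2,\dots\}$, $(Y_t)$ is called strictly stationary (in the sense of Zhu et al.) if for every real sequence $(\omega_i)$ with $\sum_i|\omega_i|<\infty$ the limit $Y^\omega_t=\lim_{n\to\infty}\sum_{i=1}^n\omega_iY_{i,t}$ exists with probability one for every $t$, and $(Y^\omega_t)_{t\in\mathbb Z}$ is a strictly stationary real process. *Theorem.* There are finite constants $C_r,D_r$ ($r\ge1$), depending only on $r$, $p$, $\beta_0$, $(\beta_{1h})$ and $(\beta_{2h})$, such that in every such model, with finitely or infinitely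 many nodes, there is a strictly stationary solution with $$\sup_{i,t}\mathrm E|Y_{i,t}|^r\le C_r,\qquad \sup_{i,t}\mathrm E\exp(r|\nu_{i,t}|)\le D_r\qquad\text{for all real } r\ge1,$$ and every other strictly stationary solution on the same probability space, driven by the same $(U_{i,l,t})$, coincides with it almost surely. -/

import Mathlib

open MeasureTheory ProbabilityTheory Filter Topology

noncomputable section

namespace PNAR

/-- The weights of a network with node set `ι`: every row of `W` is absolutely summable with
absolute sum at most one. -/
def IsWeightMatrix {ι : Type} (W : ι → ι → ℝ) : Prop :=
  ∀ i, Summable (fun j => |W i j|) ∧ ∑' j, |W i j| ≤ 1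

/-- The row-normalized adjacency matrix `a_{ij} / n_i` of a directed graph, where `n_i` is the
out-degree of `i`. -/
def rowNormalized {ι : Type} (A : ι → ι → Prop) (i j : ι) : ℝ :=
  open Classical in if A i j then ((Set.ncard {k | A i k} : ℕ) : ℝ)⁻¹ else 0

/-- Row-normalized adjacency matrices of graphs with finite out-degrees are weight matrices. -/
theorem isWeightMatrix_rowNormalized {ι : Type} (A : ι → ι → Prop)
    (hA : ∀ i, {k | A i k}.Finite) : IsWeightMatrix (rowNormalized A) := by
  classical
  intro i
  have hz : ∀ j ∉ (hA i).toFinset, |rowNormalized A i j| = 0 := by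
    intro j hj
    have : ¬ A i j := by simpa using hj
    simp [rowNormalized, this]
  refine ⟨summable_of_ne_finset_zero hz, ?_⟩
  rw [tsum_eq_sum hz]
  have h1 : ∀ j ∈ (hA i).toFinset,
      |rowNormalized A i j| = (((hA i).toFinset.card : ℕ) : ℝ)⁻¹ := by
    intro j hj
    have : A i j := by simpa using hj
    simp [rowNormalized, this, Set.ncard_eq_toFinset_card _ (hA i)]
  rw [Finset.sum_congr rfl h1, Finset.sum_const, nsmul_eq_mul]
  exact mul_inv_le_one

/-- A copula on `ι`, as a probability law on `ι → ℝ`: all marginals are uniform on `[0,1]`. -/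
def IsCopula {ι : Type} (C : Measure (ι → ℝ)) : Prop :=
  IsProbabilityMeasure C ∧
    ∀ i, C.map (fun u => u i) = (volume : Measure ℝ).restrict (Set.Icc 0 1)

/-- `U t l` (`t ∈ ℤ` a time, `l = 0, 1, …` the index of an arrival) are independent draws from the
copula `C`. -/
structure IsCopulaSample {Ω : Type*} [MeasurableSpace Ω] {ι : Type} (P : Measure Ω)
    (C : Measure (ι → ℝ)) (U : ℤ → ℕ → Ω → ι → ℝ) : Prop where
  measurable : ∀ t l, Measurable (U t l)
  indep : iIndepFun (fun q : ℤ × ℕ => U q.1 q.2) P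
  law : ∀ t l, P.map (U t l) = C

/-- The number of arrivals in `[0, lam]`, that is the largest `k` with
`x 0 + ⋯ + x (k - 1) ≤ lam`, for the sequence `x` of waiting times. -/
def arrivals (x : ℕ → ℝ) (lam : ℝ) : ℕ :=
  sSup {k : ℕ | ∑ l ∈ Finset.range k, x l ≤ lam}

/-- The copula-Poisson process of time `t`: coordinate `i`, run up to `lam`, counts the arrivals
with the unit exponential waiting times `-log U_{i,l}`. -/
def copulaPoisson {Ω : Type*} {ι : Type} (U : ℤ → ℕ → Ω → ι → ℝ) (t : ℤ) (ω : Ω) (i : ι)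
    (lam : ℝ) : ℕ :=
  arrivals (fun l => -Real.log (U t l ω i)) lam

/-- The log-intensity
`ν_{i,t} = β₀ + ∑_h β_{1h} ∑_j w_{ij} log (1 + Y_{j,t-h}) + ∑_h β_{2h} log (1 + Y_{i,t-h})`,
`h = 1, …, p` (the index `h : Fin p` stands for the lag `h + 1`). -/
def logIntensity {Ω : Type*} {ι : Type} {p : ℕ} (β₀ : ℝ) (β₁ β₂ : Fin p → ℝ) (W : ι → ι → ℝ)
    (Y : ℤ → Ω → ι → ℕ) (t : ℤ) (ω : Ω) (i : ι) : ℝ :=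
  β₀ + ∑ h : Fin p, β₁ h * ∑' j, W i j * Real.log (1 + (Y (t - ((h : ℕ) + 1)) ω j : ℝ))
    + ∑ h : Fin p, β₂ h * Real.log (1 + (Y (t - ((h : ℕ) + 1)) ω i : ℝ))

/-- The σ-algebra generated by the copula-Poisson process of time `t`. -/
abbrev noiseAt {Ω : Type*} {ι : Type} (U : ℤ → ℕ → Ω → ι → ℝ) (t : ℤ) : MeasurableSpace Ω :=
  ⨆ l, MeasurableSpace.comap (U t l) inferInstance

/-- The σ-algebra of everything that happened before time `t`. -/
abbrev past {Ω : Type*} {ι : Type} (U : ℤ → ℕ → Ω → ι → ℝ) (Y : ℤ → Ω → ι → ℕ) (t : ℤ) :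
    MeasurableSpace Ω :=
  ⨆ s, ⨆ (_ : s < t), (MeasurableSpace.comap (Y s) inferInstance ⊔ noiseAt U s)

/-- `Y` solves the log-linear PNAR(p) model driven by `U`: at every time the copula-Poisson process
is independent of the past, the series in the log-intensities converge, and
`Y_{i,t} = N_{i,t}(exp ν_{i,t})` for all nodes, almost surely. -/
structure IsSolution {Ω : Type*} [MeasurableSpace Ω] {ι : Type} {p : ℕ} (P : Measure Ω)
    (U : ℤ → ℕ → Ω → ι → ℝ) (β₀ : ℝ) (β₁ β₂ : Fin p → ℝ) (W : ι → ι → ℝ)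
    (Y : ℤ → Ω → ι → ℕ) : Prop where
  measurable : ∀ t, Measurable (Y t)
  indep_past : ∀ t, Indep (noiseAt U t) (past U Y t) P
  summable : ∀ t, ∀ᵐ ω ∂P, ∀ i, Summable (fun j => W i j * Real.log (1 + (Y t ω j : ℝ)))
  eq : ∀ t, ∀ᵐ ω ∂P, ∀ i,
    Y t ω i = copulaPoisson U t ω i (Real.exp (logIntensity β₀ β₁ β₂ W Y t ω i))

/-- Strict stationarity of a process indexed by `ℤ`: shifts do not change its law. -/
def IsStrictlyStationary {Ω E : Type*} [MeasurableSpace Ω] [MeasurableSpace E] (P : Measure Ω)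
    (X : ℤ → Ω → E) : Prop :=
  ∀ s : ℤ, IdentDistrib (fun ω (t : ℤ) => X (t + s) ω) (fun ω (t : ℤ) => X t ω) P P

/-- Strict stationarity of a process of increasing dimension: for every absolutely summable
`w`, the limit of `∑_{i < n} w_i Y_{i,t}` as `n → ∞` exists almost surely for each `t`, and the
limits form a strictly stationary real process. -/
def IsStrictlyStationaryInf {Ω : Type*} [MeasurableSpace Ω] (P : Measure Ω)
    (Y : ℤ → Ω → ℕ → ℕ) : Prop :=
  ∀ w : ℕ → ℝ, Summable (fun i => |w i|) →
    ∃ L : ℤ → Ω → ℝ,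
      (∀ t, ∀ᵐ ω ∂P,
        Tendsto (fun n => ∑ i ∈ Finset.range n, w i * (Y t ω i : ℝ)) atTop (𝓝 (L t ω))) ∧
      IsStrictlyStationary P L

/-- `E |Y_{i,t}|^r ≤ C_r` and `E exp (r |ν_{i,t}|) ≤ D_r` for all nodes, times and `r ≥ 1`. -/
def HasMomentBounds {Ω : Type*} [MeasurableSpace Ω] {ι : Type} {p : ℕ} (P : Measure Ω)
    (β₀ : ℝ) (β₁ β₂ : Fin p → ℝ) (W : ι → ι → ℝ) (Y : ℤ → Ω → ι → ℕ) (C D : ℝ → ℝ) : Prop :=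
  ∀ r : ℝ, 1 ≤ r → ∀ t i,
    (Integrable (fun ω => |(Y t ω i : ℝ)| ^ r) P ∧ ∫ ω, |(Y t ω i : ℝ)| ^ r ∂P ≤ C r) ∧
    (Integrable (fun ω => Real.exp (r * |logIntensity β₀ β₁ β₂ W Y t ω i|)) P ∧
      ∫ ω, Real.exp (r * |logIntensity β₀ β₁ β₂ W Y t ω i|) ∂P ≤ D r)

end PNAR

end

noncomputable section

namespace PNAR

open scoped ENNReal Nat

/-! ### Counting arrivals -/

/-! On the scale `log (1 + Y)` the model is a contraction in mean. For a unit-rate Poisson process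
`N` the derivative of `∑ k, P(N_y > k) / (k + 1)` is `(1 - exp (-y)) / y ≤ 1 / y`, and `log (1 + n)
- log (1 + m) ≤ ∑ 1 / (k + 1)` over `m ≤ k < n`. Hence `E |log (1 + N (exp a)) - log (1 + N (exp
b))| ≤ |a - b|` (`lintegral_log_arrivals_exp_sub_le`). The noise of time `t` is independent of the
past, so this holds with random `a`, `b` from the past and on past events
(`setLIntegral_logCount_sub_le`). As the log-intensity is linear in the log-counts with total
absolute weight `c = ∑ (|β₁ h| + |β₂ h|) < 1`, one step shrinks distances by `c`.

Existence: the Picard iterates from zero are Cauchy in `L¹` on the log scale, uniformly over nodes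
and times. Being integers, they are almost surely eventually constant at each node and time. The
limit `picardLimit` solves the model, and it is stationary because it is a shift-equivariant
measurable functional of independent, identically distributed noise.

Moments: `E (1 + N_lam)^n ≤ 2^n lam^n + (2n)^n`. Since `c < 1`, convexity leaves room to spare: `exp
(n |ν|)` is bounded by a constant plus an arbitrarily small multiple of the weighted sum of the `(1
+ Y)^n` (`ofReal_exp_le_of_weights`). The bound `countConst` therefore reproduces itself along the
iteration and passes to the limit by Fatou. It involves neither the network nor the copula.

Uniqueness: another stationary solution `Y` has no moments a priori. A gliding hump argument
(`smallCombinations_of_finite`) shows that combinations of its counts with small total weight are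
small in probability, uniformly in time. Running the recursion back from `t` to `s` bounds the mean
distance at `t` by a combination of distances near time `s`, of total weight `ρ^(t-s)`
(`exists_backward_weights`). On the event, known just after time `s`, that this combination is
small, contraction bounds the mean distance at `t`; the complementary event is unlikely. Letting `s
→ -∞` gives equality. -/

lemma measurable_sSup_nat {α : Type*} [MeasurableSpace α] {p : α → ℕ → Prop}
    (hp : ∀ k, MeasurableSet {a | p a k}) : Measurable fun a => sSup {k | p a k} := by
  -- `sSup` returns 0 for the empty and for unbounded sets, so only the nonzero levels have a clean
  -- description; level 0 is treated as their complement.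
  have key : ∀ n : ℕ, n ≠ 0 → MeasurableSet ((fun a => sSup {k | p a k}) ⁻¹' {n}) := by
    intro n hn
    have : (fun a => sSup {k | p a k}) ⁻¹' {n}
        = {a | p a n} ∩ ⋂ m : ℕ, ({a | p a m}ᶜ ∪ {_a | m ≤ n}) := by
      ext a
      simp only [Set.mem_preimage, Set.mem_singleton_iff, Set.mem_inter_iff, Set.mem_ofPred_eq,
        Set.mem_iInter, Set.mem_union, Set.mem_compl_iff]
      constructor
      · intro h
        have hb : BddAbove {k | p a k} := by
          by_contra hb
          exact hn (by rw [← h, Nat.sSup_of_not_bddAbove hb])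
        have hne : {k | p a k}.Nonempty := by
          by_contra hne
          rw [Set.not_nonempty_iff_eq_empty] at hne
          rw [hne] at h
          exact hn (by rw [← h]; simp)
        refine ⟨by rw [← h]; exact Nat.sSup_mem hne hb, fun m => ?_⟩
        by_cases hm : p a m
        · exact Or.inr (h ▸ le_csSup hb hm)
        · exact Or.inl hm
      · rintro ⟨h1, h2⟩
        have h3 : ∀ m ∈ {k | p a k}, m ≤ n := fun m hm => (h2 m).resolve_left (by simpa using hm)
        exact IsGreatest.csSup_eq ⟨h1, h3⟩
    rw [this]
    exact (hp n).inter (MeasurableSet.iInter fun m => (hp m).compl.union (MeasurableSet.const _))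
  refine measurable_to_countable' fun n => ?_
  by_cases hn : n = 0
  · have : (fun a => sSup {k | p a k}) ⁻¹' {n}
        = (⋃ m : ℕ, (fun a => sSup {k | p a k}) ⁻¹' {m + 1})ᶜ := by
      ext a
      simp only [Set.mem_preimage, Set.mem_singleton_iff, Set.mem_compl_iff, Set.mem_iUnion,
        not_exists, hn]
      constructor
      · intro h m
        omega
      · intro h
        by_contra h0
        obtain ⟨m, hm⟩ := Nat.exists_eq_succ_of_ne_zero h0
        exact h m hm
    rw [this]
    exact (MeasurableSet.iUnion fun m => key _ (by omega)).compl
  · exact key n hn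

lemma measurable_arrivals : Measurable fun z : (ℕ → ℝ) × ℝ => arrivals z.1 z.2 := by
  unfold arrivals
  refine measurable_sSup_nat fun k => measurableSet_le ?_ measurable_snd
  fun_prop

/-- For nonnegative waiting times, `lam < ∑_{l<k} x l` says that fewer than `k` arrivals happen in
`[0, lam]`, provided that only finitely many do. -/
lemma arrivals_lt_iff {x : ℕ → ℝ} (hx : ∀ l, 0 ≤ x l) {lam : ℝ} (h0 : 0 ≤ lam)
    (hlam : ∃ k, lam < ∑ l ∈ Finset.range k, x l) (k : ℕ) :
    arrivals x lam < k ↔ lam < ∑ l ∈ Finset.range k, x l := by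
  have hmono : Monotone fun k => ∑ l ∈ Finset.range k, x l := fun a b hab =>
    Finset.sum_le_sum_of_subset_of_nonneg (Finset.range_mono hab) fun l _ _ => hx l
  obtain ⟨k₀, hk₀⟩ := hlam
  have hb : BddAbove {k : ℕ | ∑ l ∈ Finset.range k, x l ≤ lam} := by
    refine ⟨k₀, fun k hk => ?_⟩
    by_contra h
    exact absurd (hk₀.trans_le ((hmono (not_le.1 h).le).trans hk)) (lt_irrefl _)
  have hne : {k : ℕ | ∑ l ∈ Finset.range k, x l ≤ lam}.Nonempty := ⟨0, by simpa using h0⟩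
  have hmem : ∑ l ∈ Finset.range (arrivals x lam), x l ≤ lam := Nat.sSup_mem hne hb
  constructor
  · intro h
    by_contra h'
    exact absurd (le_csSup hb (not_lt.1 h')) (not_le.2 h)
  · intro h
    by_contra h'
    exact absurd (h.trans_le ((hmono (not_lt.1 h')).trans hmem)) (lt_irrefl _)

/-! ### The Poisson distribution function -/

/-- The probability that a Poisson variable of mean `y` is smaller than `k`. -/
def poissonTail (k : ℕ) (y : ℝ) : ℝ := Real.exp (-y) * ∑ j ∈ Finset.range k, y ^ j / j !

lemma poissonTail_succ (k : ℕ) (y : ℝ) :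
    poissonTail (k + 1) y = poissonTail k y + Real.exp (-y) * (y ^ k / k !) := by
  simp [poissonTail, Finset.sum_range_succ, mul_add]

lemma poissonTail_nonneg (k : ℕ) {y : ℝ} (hy : 0 ≤ y) : 0 ≤ poissonTail k y := by
  unfold poissonTail; positivity

lemma hasSum_pow_div_factorial (y : ℝ) : HasSum (fun j : ℕ => y ^ j / j !) (Real.exp y) := by
  rw [Real.exp_eq_exp_ℝ]
  exact NormedSpace.expSeries_div_hasSum_exp y

lemma tendsto_poissonTail (y : ℝ) : Tendsto (fun k => poissonTail k y) atTop (𝓝 1) := by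
  have h := ((hasSum_pow_div_factorial y).tendsto_sum_nat).const_mul (Real.exp (-y))
  rw [← Real.exp_add, neg_add_cancel, Real.exp_zero] at h
  exact h

/-- The derivative of a Poisson probability in the mean is the difference of two consecutive ones,
so the sum telescopes to its last term. -/
lemma hasDerivAt_poissonTail (k : ℕ) (y : ℝ) :
    HasDerivAt (poissonTail (k + 1)) (-(Real.exp (-y) * (y ^ k / k !))) y := by
  have he : HasDerivAt (fun y : ℝ => Real.exp (-y)) (-Real.exp (-y)) y := by
    simpa using (hasDerivAt_neg y).exp
  induction k with
  | zero =>
    have : poissonTail 1 = fun y => Real.exp (-y) := by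
      funext y; simp [poissonTail]
    simpa [this] using he
  | succ k ih =>
    have h2 : HasDerivAt (fun y : ℝ => Real.exp (-y) * (y ^ (k + 1) / (k + 1) !))
        (-Real.exp (-y) * (y ^ (k + 1) / (k + 1) !) + Real.exp (-y) * (y ^ k / k !)) y := by
      refine he.mul ?_
      have := (hasDerivAt_pow (k + 1) y).div_const ((k + 1) ! : ℝ)
      convert this using 1
      rw [Nat.factorial_succ]
      push_cast
      have : (k ! : ℝ) ≠ 0 := by positivity
      field_simp
    have h3 := ih.add h2
    have h4 : poissonTail (k + 1 + 1)
        = poissonTail (k + 1) + fun y : ℝ => Real.exp (-y) * (y ^ (k + 1) / (k + 1) !) := by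
      funext y
      exact poissonTail_succ (k + 1) y
    rw [h4]
    exact h3.congr_deriv (by ring)

/-- The function `log y + ∑_{k<n} P(N_y ≤ k) / (k + 1)` is increasing in `y`. -/
lemma sum_poissonTail_sub_le (n : ℕ) {a b : ℝ} (ha : 0 < a) (hab : a ≤ b) :
    ∑ k ∈ Finset.range n, 1 / ((k : ℝ) + 1) * (poissonTail (k + 1) a - poissonTail (k + 1) b)
      ≤ Real.log b - Real.log a := by
  have hd : ∀ y ∈ Set.Ioi (0 : ℝ), HasDerivAt
      (fun y => Real.log y + ∑ k ∈ Finset.range n, 1 / ((k : ℝ) + 1) * poissonTail (k + 1) y)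
      (y⁻¹ + ∑ k ∈ Finset.range n, 1 / ((k : ℝ) + 1) * -(Real.exp (-y) * (y ^ k / k !))) y := by
    intro y hy
    refine (Real.hasDerivAt_log (ne_of_gt hy)).add ?_
    exact HasDerivAt.fun_sum fun k _ => (hasDerivAt_poissonTail k y).const_mul _
  have hmono : MonotoneOn (fun y => Real.log y +
      ∑ k ∈ Finset.range n, 1 / ((k : ℝ) + 1) * poissonTail (k + 1) y) (Set.Ioi 0) := by
    refine monotoneOn_of_hasDerivWithinAt_nonneg (convex_Ioi 0)
      (fun y hy => (hd y hy).continuousAt.continuousWithinAt)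
      (fun y hy => (hd y (interior_subset hy)).hasDerivWithinAt) ?_
    intro y hy
    have hy : 0 < y := interior_subset hy
    have hs := Real.sum_le_exp_of_nonneg hy.le (n + 1)
    rw [Finset.sum_range_succ'] at hs
    -- Since `y^k / ((k + 1) k!) = y⁻¹ y^(k+1) / (k + 1)!`, the negative part of the derivative is
    -- `y⁻¹` times a Poisson probability and cannot exceed `y⁻¹`.
    have h1 : ∑ k ∈ Finset.range n, 1 / ((k : ℝ) + 1) * -(Real.exp (-y) * (y ^ k / k !))
        = -(y⁻¹ * (Real.exp (-y) * ∑ k ∈ Finset.range n, y ^ (k + 1) / (k + 1) !)) := by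
      rw [Finset.mul_sum, Finset.mul_sum, ← Finset.sum_neg_distrib]
      refine Finset.sum_congr rfl fun k _ => ?_
      rw [Nat.factorial_succ]
      push_cast
      have : (k ! : ℝ) ≠ 0 := by positivity
      field_simp
      ring
    rw [h1]
    have h2 : Real.exp (-y) * ∑ k ∈ Finset.range n, y ^ (k + 1) / (k + 1) ! ≤ 1 := by
      calc _ ≤ Real.exp (-y) * Real.exp y := by
            gcongr
            refine le_trans ?_ hs
            simp
        _ = 1 := by rw [← Real.exp_add]; simp
    have h3 : y⁻¹ * (Real.exp (-y) * ∑ k ∈ Finset.range n, y ^ (k + 1) / (k + 1) !) ≤ y⁻¹ * 1 := by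
      gcongr
    linarith
  have h := hmono (Set.mem_Ioi.2 ha) (Set.mem_Ioi.2 (ha.trans_le hab)) hab
  simp only [mul_sub, Finset.sum_sub_distrib]
  simp only at h
  linarith

/-- The factorial moments of the Poisson law: terms with `k < n` vanish, and cancelling the
factorials in the others leaves the exponential series shifted by `n`. -/
lemma hasSum_descFactorial_poisson (n : ℕ) (y : ℝ) :
    HasSum (fun k : ℕ => (k.descFactorial n : ℝ) * (Real.exp (-y) * (y ^ k / k !))) (y ^ n) := by
  have h := (hasSum_pow_div_factorial y).mul_left (y ^ n * Real.exp (-y))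
  rw [mul_assoc, ← Real.exp_add, neg_add_cancel, Real.exp_zero, mul_one] at h
  rw [← hasSum_nat_add_iff' n]
  have h0 : ∑ k ∈ Finset.range n, (k.descFactorial n : ℝ) * (Real.exp (-y) * (y ^ k / k !)) = 0 :=
    Finset.sum_eq_zero fun k hk => by
      simp [Nat.descFactorial_eq_zero_iff_lt.2 (Finset.mem_range.1 hk)]
  rw [h0, sub_zero]
  refine h.congr_fun fun m => ?_
  have h1 : (m ! : ℝ) * ((m + n).descFactorial n : ℝ) = ((m + n) ! : ℝ) := by
    have := Nat.factorial_mul_descFactorial (Nat.le_add_left n m)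
    rw [Nat.add_sub_cancel] at this
    exact_mod_cast this
  have h2 : (m ! : ℝ) ≠ 0 := by positivity
  have h3 : ((m + n) ! : ℝ) ≠ 0 := by positivity
  field_simp
  rw [← h1]
  ring

/-- Either `2 * n ≤ N + 1`, and every factor of the descending factorial is at least `N + 1 - n ≥ (N
+ 1) / 2`, or `1 + N` is below `2 * n`. -/
lemma one_add_pow_le_descFactorial (n N : ℕ) :
    (1 + N) ^ n ≤ 2 ^ n * N.descFactorial n + (2 * n) ^ n := by
  by_cases h : 2 * n ≤ N + 1
  · have h1 : (N + 1 - n) ^ n ≤ N.descFactorial n := Nat.pow_sub_le_descFactorial N n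
    calc (1 + N) ^ n ≤ (2 * (N + 1 - n)) ^ n := Nat.pow_le_pow_left (by omega) n
      _ = 2 ^ n * (N + 1 - n) ^ n := mul_pow _ _ _
      _ ≤ 2 ^ n * N.descFactorial n := Nat.mul_le_mul_left _ h1
      _ ≤ _ := Nat.le_add_right _ _
  · calc (1 + N) ^ n ≤ (2 * n) ^ n := Nat.pow_le_pow_left (by omega) n
      _ ≤ _ := Nat.le_add_left _ _

/-- Telescoping, with `log x ≤ x - 1` for each ratio `(k + 2) / (k + 1)`. -/
lemma log_one_add_sub_le (m n : ℕ) (h : m ≤ n) :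
    Real.log (1 + n) - Real.log (1 + m) ≤ ∑ k ∈ Finset.Ico m n, 1 / ((k : ℝ) + 1) := by
  have h1 : Real.log (1 + n) - Real.log (1 + m)
      = ∑ k ∈ Finset.Ico m n, (Real.log (1 + (k + 1 : ℕ)) - Real.log (1 + (k : ℕ))) :=
    (Finset.sum_Ico_sub (fun k : ℕ => Real.log (1 + (k : ℝ))) h).symm
  rw [h1]
  refine Finset.sum_le_sum fun k _ => ?_
  have h2 : (0 : ℝ) < 1 + k := by positivity
  rw [← Real.log_div (by positivity) h2.ne']
  refine (Real.log_le_sub_one_of_pos (by positivity)).trans (le_of_eq ?_)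
  push_cast
  field_simp
  ring

/-! ### The Poisson law of the number of arrivals -/

section Arrivals

variable {Ω : Type*} [MeasurableSpace Ω] {P : Measure Ω} {u : ℕ → Ω → ℝ}

lemma ae_pos_le_one_of_uniform (hm : ∀ l, Measurable (u l))
    (hl : ∀ l, P.map (u l) = (volume : Measure ℝ).restrict (Set.Icc 0 1)) :
    ∀ᵐ ω ∂P, ∀ l, 0 < u l ω ∧ u l ω ≤ 1 := by
  refine ae_all_iff.2 fun l => ?_
  refine ae_of_ae_map (p := fun x : ℝ => 0 < x ∧ x ≤ 1) (hm l).aemeasurable ?_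
  rw [hl l, ← Measure.restrict_congr_set Ioc_ae_eq_Icc]
  filter_upwards [ae_restrict_mem measurableSet_Ioc] with x hx using hx

lemma ae_waiting_nonneg (hm : ∀ l, Measurable (u l))
    (hl : ∀ l, P.map (u l) = (volume : Measure ℝ).restrict (Set.Icc 0 1)) :
    ∀ᵐ ω ∂P, ∀ l, 0 ≤ -Real.log (u l ω) := by
  filter_upwards [ae_pos_le_one_of_uniform hm hl] with ω h l
  have := Real.log_nonpos (h l).1.le (h l).2
  linarith

/-- The integral needed in the induction of `measure_lt_sum_waiting`. As `exp (-(lam + log v)) = exp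
(-lam) / v`, the functions `exp (-lam) (lam + log v)^(j+1) / (j+1)!` are primitives of the terms. -/
lemma setLIntegral_poissonTail (k : ℕ) {lam : ℝ} (h0 : 0 ≤ lam) :
    ∫⁻ v in Set.Icc (Real.exp (-lam)) 1, ENNReal.ofReal (poissonTail k (lam + Real.log v))
      = ENNReal.ofReal (Real.exp (-lam) * ∑ j ∈ Finset.range k, lam ^ (j + 1) / (j + 1) !) := by
  have hpos : ∀ v ∈ Set.Icc (Real.exp (-lam)) 1, 0 < v := fun v hv =>
    (Real.exp_pos _).trans_le hv.1
  have hle : Real.exp (-lam) ≤ 1 := by simpa using h0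
  have hnn : ∀ v ∈ Set.Icc (Real.exp (-lam)) 1, 0 ≤ lam + Real.log v := fun v hv => by
    have := Real.log_le_log (Real.exp_pos _) hv.1
    rw [Real.log_exp] at this
    linarith
  have hcont : ContinuousOn (fun v => poissonTail k (lam + Real.log v))
      (Set.Icc (Real.exp (-lam)) 1) := by
    have hlog : ContinuousOn (fun v => lam + Real.log v) (Set.Icc (Real.exp (-lam)) 1) :=
      continuousOn_const.add (Real.continuousOn_log.mono fun v hv => (hpos v hv).ne')
    have hc : Continuous (poissonTail k) := by unfold poissonTail; fun_prop
    exact hc.comp_continuousOn hlog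
  have hcont_int : IntegrableOn (fun v => poissonTail k (lam + Real.log v))
      (Set.Icc (Real.exp (-lam)) 1) := hcont.integrableOn_compact isCompact_Icc
  rw [← ofReal_integral_eq_lintegral_ofReal hcont_int]
  · congr 1
    rw [integral_Icc_eq_integral_Ioc, ← intervalIntegral.integral_of_le hle]
    have hF : ∀ v ∈ Set.uIcc (Real.exp (-lam)) 1, HasDerivAt
        (fun v => Real.exp (-lam) * ∑ j ∈ Finset.range k, (lam + Real.log v) ^ (j + 1) / (j + 1) !)
        (poissonTail k (lam + Real.log v)) v := by
      intro v hv
      rw [Set.uIcc_of_le hle] at hv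
      have hv0 := hpos v hv
      have h1 : ∀ j ∈ Finset.range k, HasDerivAt
          (fun v => (lam + Real.log v) ^ (j + 1) / ((j + 1) ! : ℝ))
          ((lam + Real.log v) ^ j / j ! * v⁻¹) v := by
        intro j _
        have := (((Real.hasDerivAt_log hv0.ne').const_add lam).pow (j + 1)).div_const
          ((j + 1) ! : ℝ)
        refine this.congr_deriv ?_
        rw [Nat.factorial_succ]
        push_cast
        have : (j ! : ℝ) ≠ 0 := by positivity
        field_simp
      refine ((HasDerivAt.fun_sum h1).const_mul (Real.exp (-lam))).congr_deriv ?_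
      rw [poissonTail, ← Finset.sum_mul, neg_add, Real.exp_add, Real.exp_neg (Real.log v),
        Real.exp_log hv0]
      ring
    rw [intervalIntegral.integral_eq_sub_of_hasDerivAt hF
      (by rw [intervalIntegrable_iff_integrableOn_Icc_of_le hle]; exact hcont_int)]
    simp
  · filter_upwards [ae_restrict_mem measurableSet_Icc] with v hv
    exact poissonTail_nonneg k (hnn v hv)

/-- Induction on `k`, conditioning on the last waiting time `-log v` with `v` uniform. If `v < exp
(-lam)` it exceeds `lam` alone, which contributes `exp (-lam)`; otherwise the first `k` waiting
times must exceed `lam + log v ≥ 0`. -/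
lemma measure_lt_sum_waiting [IsProbabilityMeasure P] (hm : ∀ l, Measurable (u l))
    (hi : iIndepFun u P)
    (hl : ∀ l, P.map (u l) = (volume : Measure ℝ).restrict (Set.Icc 0 1)) (k : ℕ)
    {lam : ℝ} (h0 : 0 ≤ lam) :
    P {ω | lam < ∑ l ∈ Finset.range k, -Real.log (u l ω)} = ENNReal.ofReal (poissonTail k lam) := by
  induction k generalizing lam with
  | zero => simp [poissonTail, not_lt.2 h0]
  | succ k ih =>
    set S : Ω → ℝ := fun ω => ∑ l ∈ Finset.range k, -Real.log (u l ω) with hS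
    have hSm : Measurable S := by fun_prop
    have hind : IndepFun S (u k) P := by
      have h2 : IndepFun (fun ω => fun l : Finset.range k => u l ω)
          (fun ω => fun l : ({k} : Finset ℕ) => u l ω) P := by
        exact hi.indepFun_finset (Finset.range k) {k} (by simp) hm
      have hφ : Measurable fun x : (Finset.range k) → ℝ => ∑ l, -Real.log (x l) := by fun_prop
      have hψ : Measurable fun x : (({k} : Finset ℕ) → ℝ) => x ⟨k, by simp⟩ := by fun_prop
      have h3 := h2.comp hφ hψ
      have h4 : S = (fun x : (Finset.range k) → ℝ => ∑ l, -Real.log (x l)) ∘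
          (fun ω => fun l : Finset.range k => u l ω) := by
        funext ω
        simp only [hS, Function.comp]
        exact (Finset.sum_coe_sort (Finset.range k) fun l => -Real.log (u l ω)).symm
      rw [h4]
      exact h3
    have hprod := (indepFun_iff_map_prod_eq_prod_map_map hSm.aemeasurable
      (hm k).aemeasurable).1 hind
    have hset : MeasurableSet {z : ℝ × ℝ | lam < z.1 + -Real.log z.2} :=
      measurableSet_lt measurable_const (by fun_prop)
    have h1 : P {ω | lam < ∑ l ∈ Finset.range (k + 1), -Real.log (u l ω)}
        = ∫⁻ v in Set.Icc (0 : ℝ) 1, P {ω | lam + Real.log v < S ω} := by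
      have hpre : {ω | lam < ∑ l ∈ Finset.range (k + 1), -Real.log (u l ω)}
          = (fun ω => (S ω, u k ω)) ⁻¹' {z : ℝ × ℝ | lam < z.1 + -Real.log z.2} := by
        ext ω
        simp only [Finset.sum_range_succ, hS, Set.mem_preimage, Set.mem_ofPred_eq]
      have : IsProbabilityMeasure (P.map S) := Measure.isProbabilityMeasure_map hSm.aemeasurable
      have : IsProbabilityMeasure (P.map (u k)) :=
        Measure.isProbabilityMeasure_map (hm k).aemeasurable
      rw [hpre, ← Measure.map_apply (hSm.prodMk (hm k)) hset, hprod, Measure.prod_apply_symm hset,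
        hl k]
      refine lintegral_congr fun v => ?_
      rw [Measure.map_apply hSm (measurable_prodMk_right hset)]
      congr 1
      ext ω
      simp only [Set.mem_preimage, Set.mem_ofPred_eq]
      constructor <;> intro h <;> linarith
    have hnn : ∀ᵐ ω ∂P, 0 ≤ S ω := by
      filter_upwards [ae_waiting_nonneg hm hl] with ω h using Finset.sum_nonneg fun l _ => h l
    have hle : Real.exp (-lam) ≤ 1 := by simpa using h0
    -- The point `v = 0`, where `Real.log` has the default value 0, is discarded as a null set.
    have hsplit : Set.Icc (0 : ℝ) 1 =ᵐ[volume]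
        (Set.Ioo 0 (Real.exp (-lam)) ∪ Set.Icc (Real.exp (-lam)) 1 : Set ℝ) := by
      have h2 : (Set.Ioo 0 (Real.exp (-lam)) ∪ Set.Icc (Real.exp (-lam)) 1 : Set ℝ)
          = Set.Ioc 0 1 := by
        ext v
        have := Real.exp_pos (-lam)
        simp only [Set.mem_union, Set.mem_Ioo, Set.mem_Icc, Set.mem_Ioc]
        constructor
        · rintro (⟨h1, h2⟩ | ⟨h1, h2⟩)
          · exact ⟨h1, (h2.trans_le hle).le⟩
          · exact ⟨this.trans_le h1, h2⟩
        · rintro ⟨h1, h2⟩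
          rcases lt_or_ge v (Real.exp (-lam)) with h | h
          · exact Or.inl ⟨h1, h⟩
          · exact Or.inr ⟨h, h2⟩
      rw [h2]
      exact Ioc_ae_eq_Icc.symm
    rw [h1, setLIntegral_congr hsplit, lintegral_union measurableSet_Icc]
    · have h2 : ∫⁻ v in Set.Ioo 0 (Real.exp (-lam)), P {ω | lam + Real.log v < S ω}
          = ENNReal.ofReal (Real.exp (-lam)) := by
        have : ∫⁻ v in Set.Ioo 0 (Real.exp (-lam)), P {ω | lam + Real.log v < S ω}
            = ∫⁻ v in Set.Ioo 0 (Real.exp (-lam)), 1 := by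
          refine setLIntegral_congr_fun measurableSet_Ioo fun v hv => ?_
          have hv' : lam + Real.log v < 0 := by
            have := Real.log_lt_log hv.1 hv.2
            rw [Real.log_exp] at this
            linarith
          refine (prob_compl_eq_zero_iff (measurableSet_lt measurable_const hSm)).1 ?_
          refine measure_mono_null (t := {ω | ¬ 0 ≤ S ω}) (fun ω h => ?_) hnn
          simp only [Set.mem_compl_iff, Set.mem_ofPred_eq, not_lt, not_le] at h ⊢
          exact h.trans_lt hv'
        rw [this]
        simp
      have h3 : ∫⁻ v in Set.Icc (Real.exp (-lam)) 1, P {ω | lam + Real.log v < S ω}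
          = ∫⁻ v in Set.Icc (Real.exp (-lam)) 1,
              ENNReal.ofReal (poissonTail k (lam + Real.log v)) := by
        refine setLIntegral_congr_fun measurableSet_Icc fun v hv => ih ?_
        have := Real.log_le_log (Real.exp_pos _) hv.1
        rw [Real.log_exp] at this
        linarith
      rw [h2, h3, setLIntegral_poissonTail k h0, ← ENNReal.ofReal_add (by positivity)
        (by positivity)]
      congr 1
      rw [poissonTail, Finset.sum_range_succ']
      simp
      ring
    · rw [Set.disjoint_left]
      rintro v ⟨_, h1⟩ ⟨h2, _⟩
      linarith

/-- Almost surely the arrivals are determined by the partial sums of the waiting times. -/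
lemma ae_arrivals_lt_iff [IsProbabilityMeasure P] (hm : ∀ l, Measurable (u l))
    (hi : iIndepFun u P)
    (hl : ∀ l, P.map (u l) = (volume : Measure ℝ).restrict (Set.Icc 0 1))
    {lam : ℝ} (h0 : 0 ≤ lam) :
    ∀ᵐ ω ∂P, ∀ k, arrivals (fun l => -Real.log (u l ω)) lam < k ↔
      lam < ∑ l ∈ Finset.range k, -Real.log (u l ω) := by
  have hfin : ∀ᵐ ω ∂P, ∃ k, lam < ∑ l ∈ Finset.range k, -Real.log (u l ω) := by
    have hms : ∀ k, MeasurableSet {ω | lam < ∑ l ∈ Finset.range k, -Real.log (u l ω)} := fun k =>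
      measurableSet_lt measurable_const (by fun_prop)
    -- The Poisson distribution functions tend to 1, so almost surely some partial sum passes `lam`;
    -- this excludes the default value of `sSup` in `arrivals`.
    have h1 : (1 : ℝ≥0∞) ≤ P {ω | ∃ k, lam < ∑ l ∈ Finset.range k, -Real.log (u l ω)} := by
      have ht : Tendsto (fun k => ENNReal.ofReal (poissonTail k lam)) atTop (𝓝 1) := by
        simpa using ENNReal.tendsto_ofReal (tendsto_poissonTail lam)
      refine le_of_tendsto ht (Eventually.of_forall fun k => ?_)
      rw [← measure_lt_sum_waiting hm hi hl k h0]
      exact measure_mono fun ω h => ⟨k, h⟩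
    have h2 : MeasurableSet {ω | ∃ k, lam < ∑ l ∈ Finset.range k, -Real.log (u l ω)} := by
      have : {ω | ∃ k, lam < ∑ l ∈ Finset.range k, -Real.log (u l ω)}
          = ⋃ k, {ω | lam < ∑ l ∈ Finset.range k, -Real.log (u l ω)} := by
        ext ω; simp
      rw [this]
      exact MeasurableSet.iUnion hms
    exact (prob_compl_eq_zero_iff h2).2 (le_antisymm prob_le_one h1)
  filter_upwards [hfin, ae_waiting_nonneg hm hl] with ω h1 h2 k
  exact arrivals_lt_iff h2 h0 h1 k

lemma measurable_arrivals_waiting (hm : ∀ l, Measurable (u l)) (lam : ℝ) :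
    Measurable fun ω => arrivals (fun l => -Real.log (u l ω)) lam :=
  measurable_arrivals.comp (f := fun ω => ((fun l => -Real.log (u l ω)), lam))
    (Measurable.prodMk (by fun_prop) measurable_const)

lemma measure_arrivals_lt [IsProbabilityMeasure P] (hm : ∀ l, Measurable (u l))
    (hi : iIndepFun u P)
    (hl : ∀ l, P.map (u l) = (volume : Measure ℝ).restrict (Set.Icc 0 1)) (k : ℕ)
    {lam : ℝ} (h0 : 0 ≤ lam) :
    P {ω | arrivals (fun l => -Real.log (u l ω)) lam < k} = ENNReal.ofReal (poissonTail k lam) := by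
  rw [← measure_lt_sum_waiting hm hi hl k h0]
  refine measure_congr ?_
  filter_upwards [ae_arrivals_lt_iff hm hi hl h0] with ω h
  exact propext (h k)

lemma measure_arrivals_eq [IsProbabilityMeasure P] (hm : ∀ l, Measurable (u l))
    (hi : iIndepFun u P)
    (hl : ∀ l, P.map (u l) = (volume : Measure ℝ).restrict (Set.Icc 0 1)) (k : ℕ)
    {lam : ℝ} (h0 : 0 ≤ lam) :
    P {ω | arrivals (fun l => -Real.log (u l ω)) lam = k}
      = ENNReal.ofReal (Real.exp (-lam) * (lam ^ k / k !)) := by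
  have hmeas := measurable_arrivals_waiting hm lam
  have h1 : {ω | arrivals (fun l => -Real.log (u l ω)) lam = k}
      = {ω | arrivals (fun l => -Real.log (u l ω)) lam < k + 1} \
        {ω | arrivals (fun l => -Real.log (u l ω)) lam < k} := by
    ext ω
    simp only [Set.mem_ofPred_eq, Set.mem_sdiff]
    omega
  rw [h1, measure_sdiff, measure_arrivals_lt hm hi hl _ h0, measure_arrivals_lt hm hi hl _ h0,
    ← ENNReal.ofReal_sub _ (poissonTail_nonneg k h0), poissonTail_succ]
  · congr 1; ring
  · intro ω h
    simp only [Set.mem_ofPred_eq] at h ⊢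
    omega
  · exact (measurableSet_lt hmeas measurable_const).nullMeasurableSet
  · exact measure_ne_top _ _

/-- Moments of the number of arrivals. -/
lemma lintegral_one_add_arrivals_pow_le [IsProbabilityMeasure P] (hm : ∀ l, Measurable (u l))
    (hi : iIndepFun u P)
    (hl : ∀ l, P.map (u l) = (volume : Measure ℝ).restrict (Set.Icc 0 1)) (n : ℕ)
    {lam : ℝ} (h0 : 0 ≤ lam) :
    ∫⁻ ω, ENNReal.ofReal ((1 + (arrivals (fun l => -Real.log (u l ω)) lam : ℝ)) ^ n) ∂P
      ≤ ENNReal.ofReal (2 ^ n * lam ^ n + (2 * n) ^ n) := by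
  have hmeas := measurable_arrivals_waiting hm lam
  calc ∫⁻ ω, ENNReal.ofReal ((1 + (arrivals (fun l => -Real.log (u l ω)) lam : ℝ)) ^ n) ∂P
      ≤ ∫⁻ ω, (ENNReal.ofReal (2 ^ n) * ENNReal.ofReal
          ((arrivals (fun l => -Real.log (u l ω)) lam).descFactorial n)
          + ENNReal.ofReal ((2 * n) ^ n)) ∂P := by
        refine lintegral_mono fun ω => ?_
        rw [← ENNReal.ofReal_mul (by positivity), ← ENNReal.ofReal_add (by positivity)
          (by positivity)]
        refine ENNReal.ofReal_le_ofReal ?_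
        exact_mod_cast one_add_pow_le_descFactorial n _
    _ = ENNReal.ofReal (2 ^ n) * ∫⁻ ω, ENNReal.ofReal
          ((arrivals (fun l => -Real.log (u l ω)) lam).descFactorial n) ∂P
          + ENNReal.ofReal ((2 * n) ^ n) := by
        rw [lintegral_add_right _ measurable_const, lintegral_const_mul]
        · simp
        · exact (measurable_of_countable fun k : ℕ =>
            ENNReal.ofReal (k.descFactorial n : ℝ)).comp hmeas
    _ = ENNReal.ofReal (2 ^ n) * ENNReal.ofReal (lam ^ n) + ENNReal.ofReal ((2 * n) ^ n) := by
        congr 2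
        rw [← lintegral_map (f := fun k : ℕ => ENNReal.ofReal (k.descFactorial n : ℝ))
          (measurable_of_countable _) hmeas, lintegral_countable']
        have hs := hasSum_descFactorial_poisson n lam
        rw [← hs.tsum_eq, ENNReal.ofReal_tsum_of_nonneg (fun k => by positivity) hs.summable]
        refine tsum_congr fun k => ?_
        rw [Measure.map_apply hmeas (measurableSet_singleton k),
          ENNReal.ofReal_mul (by positivity), ← measure_arrivals_eq hm hi hl k h0]
        rfl
    _ = _ := by
        rw [← ENNReal.ofReal_mul (by positivity), ← ENNReal.ofReal_add (by positivity)
          (by positivity)]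

/-- The increment of the logarithm is at most `∑ 1 / (k + 1)` over `N_a ≤ k < N_b`. In mean this is
`∑ (P(N_a ≤ k) - P(N_b ≤ k)) / (k + 1)`, because `N_a ≤ N_b` almost surely, and the partial sums are
controlled by `sum_poissonTail_sub_le`. -/
lemma lintegral_log_arrivals_sub_le_of_le [IsProbabilityMeasure P] (hm : ∀ l, Measurable (u l))
    (hi : iIndepFun u P)
    (hl : ∀ l, P.map (u l) = (volume : Measure ℝ).restrict (Set.Icc 0 1))
    {a b : ℝ} (ha : 0 < a) (hab : a ≤ b) :
    ∫⁻ ω, ‖Real.log (1 + (arrivals (fun l => -Real.log (u l ω)) b : ℝ))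
        - Real.log (1 + (arrivals (fun l => -Real.log (u l ω)) a : ℝ))‖ₑ ∂P
      ≤ ENNReal.ofReal (Real.log b - Real.log a) := by
  have hb := ha.trans_le hab
  have hma := measurable_arrivals_waiting hm a
  have hmb := measurable_arrivals_waiting hm b
  have hset : ∀ k : ℕ, MeasurableSet {ω | arrivals (fun l => -Real.log (u l ω)) a < k + 1 ∧
      ¬ arrivals (fun l => -Real.log (u l ω)) b < k + 1} := fun k =>
    (measurableSet_lt hma measurable_const).inter (measurableSet_lt hmb measurable_const).compl
  have hle : ∀ᵐ ω ∂P, arrivals (fun l => -Real.log (u l ω)) a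
      ≤ arrivals (fun l => -Real.log (u l ω)) b := by
    filter_upwards [ae_arrivals_lt_iff hm hi hl ha.le, ae_arrivals_lt_iff hm hi hl hb.le]
      with ω h1 h2
    refine Nat.le_of_lt_succ ((h1 _).2 (hab.trans_lt ((h2 _).1 (Nat.lt_succ_self _))))
  calc ∫⁻ ω, ‖Real.log (1 + (arrivals (fun l => -Real.log (u l ω)) b : ℝ))
        - Real.log (1 + (arrivals (fun l => -Real.log (u l ω)) a : ℝ))‖ₑ ∂P
      ≤ ∫⁻ ω, ∑' k : ℕ, ({ω | arrivals (fun l => -Real.log (u l ω)) a < k + 1 ∧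
          ¬ arrivals (fun l => -Real.log (u l ω)) b < k + 1}).indicator
            (fun _ => ENNReal.ofReal (1 / ((k : ℝ) + 1))) ω ∂P := by
        refine lintegral_mono_ae ?_
        filter_upwards [hle] with ω h
        set m := arrivals (fun l => -Real.log (u l ω)) a
        set n := arrivals (fun l => -Real.log (u l ω)) b
        have hmn : (m : ℝ) ≤ n := by exact_mod_cast h
        have h1 : 0 ≤ Real.log (1 + n) - Real.log (1 + m) :=
          sub_nonneg.2 (Real.log_le_log (by positivity) (by linarith))
        rw [Real.enorm_of_nonneg h1]
        refine (ENNReal.ofReal_le_ofReal (log_one_add_sub_le m n h)).trans ?_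
        rw [ENNReal.ofReal_sum_of_nonneg fun k _ => by positivity]
        refine le_trans (le_of_eq (Finset.sum_congr rfl fun k hk => ?_))
          (ENNReal.sum_le_tsum (Finset.Ico m n))
        rw [Finset.mem_Ico] at hk
        rw [Set.indicator_of_mem]
        simp only [Set.mem_ofPred_eq]
        omega
    _ = ∑' k : ℕ, ENNReal.ofReal (1 / ((k : ℝ) + 1) *
          (poissonTail (k + 1) a - poissonTail (k + 1) b)) := by
        rw [lintegral_tsum fun k => (measurable_const.indicator (hset k)).aemeasurable]
        refine tsum_congr fun k => ?_
        rw [lintegral_indicator_const (hset k), ENNReal.ofReal_mul (by positivity)]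
        congr 1
        rw [ENNReal.ofReal_sub _ (poissonTail_nonneg _ hb.le)]
        have e1 := measure_arrivals_lt hm hi hl (k + 1) ha.le
        have e2 := measure_arrivals_lt hm hi hl (k + 1) hb.le
        rw [← e1, ← e2]
        refine ENNReal.eq_sub_of_add_eq (measure_ne_top _ _) ?_
        rw [← measure_inter_add_sdiff {ω | arrivals (fun l => -Real.log (u l ω)) a < k + 1}
          (measurableSet_lt hmb (measurable_const (a := k + 1))), add_comm]
        congr 1
        refine measure_congr ?_
        filter_upwards [hle] with ω h
        exact propext ⟨fun h' => ⟨lt_of_le_of_lt h h', h'⟩, fun h' => h'.2⟩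
    _ ≤ ENNReal.ofReal (Real.log b - Real.log a) := by
        refine ENNReal.tsum_le_of_sum_range_le fun n => ?_
        rw [← ENNReal.ofReal_sum_of_nonneg]
        · exact ENNReal.ofReal_le_ofReal (sum_poissonTail_sub_le n ha hab)
        · intro k _
          refine mul_nonneg (by positivity) (sub_nonneg.2 ?_)
          have e1 := measure_arrivals_lt hm hi hl (k + 1) ha.le
          have e2 := measure_arrivals_lt hm hi hl (k + 1) hb.le
          rw [← ENNReal.ofReal_le_ofReal_iff (poissonTail_nonneg _ ha.le), ← e1, ← e2]
          refine measure_mono_ae ?_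
          filter_upwards [hle] with ω h h'
          exact lt_of_le_of_lt h h'

/-- On the logarithmic scale, the number of arrivals is a Lipschitz function of the
log-intensity, in mean. -/
lemma lintegral_log_arrivals_exp_sub_le [IsProbabilityMeasure P] (hm : ∀ l, Measurable (u l))
    (hi : iIndepFun u P)
    (hl : ∀ l, P.map (u l) = (volume : Measure ℝ).restrict (Set.Icc 0 1)) (a b : ℝ) :
    ∫⁻ ω, ‖Real.log (1 + (arrivals (fun l => -Real.log (u l ω)) (Real.exp a) : ℝ))
        - Real.log (1 + (arrivals (fun l => -Real.log (u l ω)) (Real.exp b) : ℝ))‖ₑ ∂P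
      ≤ ‖a - b‖ₑ := by
  rcases le_total b a with h | h
  · refine (lintegral_log_arrivals_sub_le_of_le hm hi hl (Real.exp_pos b)
      (Real.exp_le_exp.2 h)).trans ?_
    rw [Real.log_exp, Real.log_exp, Real.enorm_of_nonneg (sub_nonneg.2 h)]
  · simp_rw [← enorm_neg (Real.log _ - Real.log _), neg_sub]
    refine (lintegral_log_arrivals_sub_le_of_le hm hi hl (Real.exp_pos a)
      (Real.exp_le_exp.2 h)).trans ?_
    rw [Real.log_exp, Real.log_exp, ← enorm_neg, neg_sub, Real.enorm_of_nonneg (sub_nonneg.2 h)]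

end Arrivals

/-! ### Integrating out the noise of one time -/

/-- Integrating out a variable that is independent of `X`. -/
lemma lintegral_le_of_indepFun {Ω E F : Type*} [MeasurableSpace Ω] [MeasurableSpace E]
    [MeasurableSpace F] {P : Measure Ω} [IsProbabilityMeasure P] {ξ : Ω → E} {X : Ω → F}
    (hξ : Measurable ξ) (hX : Measurable X) (hi : IndepFun ξ X P) {f : E × F → ℝ≥0∞}
    (hf : Measurable f) {g : F → ℝ≥0∞} (hg : Measurable g)
    (h : ∀ y, ∫⁻ ω, f (ξ ω, y) ∂P ≤ g y) :
    ∫⁻ ω, f (ξ ω, X ω) ∂P ≤ ∫⁻ ω, g (X ω) ∂P := by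
  have : IsProbabilityMeasure (P.map ξ) := Measure.isProbabilityMeasure_map hξ.aemeasurable
  have : IsProbabilityMeasure (P.map X) := Measure.isProbabilityMeasure_map hX.aemeasurable
  rw [← lintegral_map (f := f) hf (hξ.prodMk hX),
    (indepFun_iff_map_prod_eq_prod_map_map hξ.aemeasurable hX.aemeasurable).1 hi,
    lintegral_prod_symm' _ hf, ← lintegral_map hg hX]
  refine lintegral_mono fun y => ?_
  rw [lintegral_map (f := fun x => f (x, y)) (hf.comp measurable_prodMk_right) hξ]
  exact h y

/-- The log-scale count `log (1 + k)`. -/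
abbrev logCount (k : ℕ) : ℝ := Real.log (1 + (k : ℝ))

lemma logCount_nonneg (k : ℕ) : 0 ≤ logCount k := Real.log_nonneg (by simp)

lemma logCount_le (k : ℕ) : logCount k ≤ k := by
  have := Real.log_le_sub_one_of_pos (by positivity : (0 : ℝ) < 1 + k)
  simp only [logCount]
  linarith

lemma exp_logCount (k : ℕ) : Real.exp (logCount k) = 1 + k := Real.exp_log (by positivity)

lemma logCount_injective : Function.Injective logCount := by
  intro a b h
  have h1 := exp_logCount a
  rw [h, exp_logCount b] at h1
  have h2 : (b : ℝ) = a := by linarith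
  exact_mod_cast h2.symm

section Noise

variable {Ω : Type*} {m mΩ : MeasurableSpace Ω} {ι : Type} {P : Measure Ω}
  {C : Measure (ι → ℝ)} {U : ℤ → ℕ → Ω → ι → ℝ}

lemma measurable_noiseAt (U : ℤ → ℕ → Ω → ι → ℝ) (t : ℤ) (l : ℕ) :
    Measurable[noiseAt U t] (U t l) :=
  measurable_iff_comap_le.2 (le_iSup (fun l => MeasurableSpace.comap (U t l) inferInstance) l)

lemma noiseAt_le (hU : IsCopulaSample P C U) (t : ℤ) : noiseAt U t ≤ mΩ :=
  iSup_le fun l => (hU.measurable t l).comap_le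

lemma IsCopulaSample.map_coord (hC : IsCopula C) (hU : IsCopulaSample P C U) (t : ℤ) (i : ι)
    (l : ℕ) : P.map (fun ω => U t l ω i) = (volume : Measure ℝ).restrict (Set.Icc 0 1) := by
  rw [← hC.2 i, ← hU.law t l, Measure.map_map (measurable_pi_apply i) (hU.measurable t l)]
  rfl

lemma IsCopulaSample.iIndepFun_coord (hU : IsCopulaSample P C U) (t : ℤ) (i : ι) :
    iIndepFun (fun l ω => U t l ω i) P := by
  have h1 := hU.indep.precomp (g := fun l : ℕ => (t, l)) (fun a b h => by simpa using h)
  exact h1.comp (fun _ x => x i) fun _ => measurable_pi_apply i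

/-- The waiting times of one node at one time are independent of every σ-algebra of which the
noise at that time is independent. -/
lemma indepFun_waiting {t : ℤ} (hi : Indep (noiseAt U t) m P) (i : ι)
    {F : Type*} [MeasurableSpace F] {X : Ω → F} (hX : Measurable[m] X) :
    IndepFun (fun ω l => -Real.log (U t l ω i)) X P := by
  rw [IndepFun_iff_Indep]
  refine indep_of_indep_of_le_left (indep_of_indep_of_le_right hi hX.comap_le) ?_
  refine Measurable.comap_le (m₁ := noiseAt U t) ?_
  refine @measurable_pi_lambda _ _ _ (noiseAt U t) _ _ fun l => ?_
  exact (Real.measurable_log.comp ((measurable_pi_apply i).comp (measurable_noiseAt U t l))).neg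

/-- Contraction: given the past, the log-scale counts are Lipschitz in the log-intensity. -/
lemma setLIntegral_logCount_sub_le [IsProbabilityMeasure P] (hC : IsCopula C)
    (hU : IsCopulaSample P C U) (hm : m ≤ mΩ) {t : ℤ} (hi : Indep (noiseAt U t) m P) (i : ι)
    {a b : Ω → ℝ} (ha : Measurable[m] a) (hb : Measurable[m] b) {A : Set Ω}
    (hA : MeasurableSet[m] A) :
    ∫⁻ ω in A, ‖logCount (copulaPoisson U t ω i (Real.exp (a ω)))
        - logCount (copulaPoisson U t ω i (Real.exp (b ω)))‖ₑ ∂P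
      ≤ ∫⁻ ω in A, ‖a ω - b ω‖ₑ ∂P := by
  have hUm : ∀ l, Measurable fun ω => U t l ω i := fun l =>
    (measurable_pi_apply i).comp (hU.measurable t l)
  -- The indicator of `A` is carried along as a further past variable, so that the restriction to
  -- `A` survives integrating out the noise.
  have hXm : Measurable[m] fun ω => ((a ω, b ω), A.indicator (fun _ => (1 : ℝ≥0∞)) ω) :=
    (ha.prodMk hb).prodMk (measurable_const.indicator hA)
  have hcount : ∀ r : (ℕ → ℝ) × (ℝ × ℝ) × ℝ≥0∞ → ℝ, Measurable r →
      Measurable fun z : (ℕ → ℝ) × (ℝ × ℝ) × ℝ≥0∞ => logCount (arrivals z.1 (Real.exp (r z))) :=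
    fun r hr => (measurable_of_countable logCount).comp
      (measurable_arrivals.comp (measurable_fst.prodMk (Real.measurable_exp.comp hr)))
  have key := lintegral_le_of_indepFun (P := P)
    (f := fun z : (ℕ → ℝ) × (ℝ × ℝ) × ℝ≥0∞ =>
      ‖logCount (arrivals z.1 (Real.exp z.2.1.1)) - logCount (arrivals z.1 (Real.exp z.2.1.2))‖ₑ
        * z.2.2)
    (g := fun y : (ℝ × ℝ) × ℝ≥0∞ => ‖y.1.1 - y.1.2‖ₑ * y.2)
    (ξ := fun ω l => -Real.log (U t l ω i))
    (measurable_pi_lambda _ fun l => by fun_prop) (hXm.mono hm le_rfl)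
    (indepFun_waiting hi i hXm)
    ((((hcount _ (by fun_prop)).sub (hcount _ (by fun_prop))).enorm).mul (by fun_prop))
    (by fun_prop) ?_
  · have hAm := hm _ hA
    have hind : ∀ (f : Ω → ℝ≥0∞), (fun ω => f ω * A.indicator (fun _ => (1 : ℝ≥0∞)) ω)
        = A.indicator f := by
      intro f
      funext ω
      by_cases h : ω ∈ A <;> simp [h]
    rw [← lintegral_indicator hAm, ← lintegral_indicator hAm,
      ← hind (fun ω => ‖logCount (copulaPoisson U t ω i (Real.exp (a ω)))
        - logCount (copulaPoisson U t ω i (Real.exp (b ω)))‖ₑ), ← hind (fun ω => ‖a ω - b ω‖ₑ)]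
    exact key
  · rintro ⟨⟨x, y⟩, e⟩
    simp only
    rw [lintegral_mul_const]
    · gcongr
      exact lintegral_log_arrivals_exp_sub_le hUm (hU.iIndepFun_coord t i)
        (hU.map_coord hC t i) x y
    · exact ((((measurable_of_countable logCount).comp (measurable_arrivals_waiting hUm _)).sub
        ((measurable_of_countable logCount).comp (measurable_arrivals_waiting hUm _))).enorm)

/-- Moments of the counts, given the past. -/
lemma lintegral_one_add_copulaPoisson_pow_le [IsProbabilityMeasure P] (hC : IsCopula C)
    (hU : IsCopulaSample P C U) (hm : m ≤ mΩ) {t : ℤ} (hi : Indep (noiseAt U t) m P) (i : ι)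
    {a : Ω → ℝ} (ha : Measurable[m] a) (n : ℕ) :
    ∫⁻ ω, ENNReal.ofReal ((1 + (copulaPoisson U t ω i (Real.exp (a ω)) : ℝ)) ^ n) ∂P
      ≤ ∫⁻ ω, ENNReal.ofReal (2 ^ n * Real.exp (a ω) ^ n + (2 * n) ^ n) ∂P := by
  have hUm : ∀ l, Measurable fun ω => U t l ω i := fun l =>
    (measurable_pi_apply i).comp (hU.measurable t l)
  refine lintegral_le_of_indepFun (P := P)
    (f := fun z : (ℕ → ℝ) × ℝ =>
      ENNReal.ofReal ((1 + (arrivals z.1 (Real.exp z.2) : ℝ)) ^ n))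
    (g := fun y : ℝ => ENNReal.ofReal (2 ^ n * Real.exp y ^ n + (2 * n) ^ n))
    (ξ := fun ω l => -Real.log (U t l ω i))
    (measurable_pi_lambda _ fun l => by fun_prop) (ha.mono hm le_rfl)
    (indepFun_waiting hi i ha) ?_ (by fun_prop) ?_
  · have h1 : Measurable fun z : (ℕ → ℝ) × ℝ => arrivals z.1 (Real.exp z.2) :=
      measurable_arrivals.comp (f := fun z : (ℕ → ℝ) × ℝ => (z.1, Real.exp z.2)) (by fun_prop)
    exact (measurable_of_countable fun k : ℕ => ENNReal.ofReal ((1 + (k : ℝ)) ^ n)).comp h1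
  · intro y
    have h := lintegral_one_add_arrivals_pow_le hUm (hU.iIndepFun_coord t i)
      (hU.map_coord hC t i) n (Real.exp_pos y).le
    simp only
    exact h

end Noise

/-! ### The log-intensity -/

/-- No convergence is assumed: if the right side is finite, `x - y` is summable, so both series
converge or both have the default sum 0. -/
lemma enorm_tsum_sub_tsum_le {ι : Type*} (x y : ι → ℝ) :
    ‖∑' j, x j - ∑' j, y j‖ₑ ≤ ∑' j, ‖x j - y j‖ₑ := by
  by_cases h : ∑' j, ‖x j - y j‖ₑ = ∞
  · rw [h]; exact le_top
  have hs : Summable fun j => x j - y j := by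
    have := ENNReal.summable_toReal h
    simp only [toReal_enorm] at this
    exact this.of_norm
  by_cases hx : Summable x
  · have hy : Summable y := by
      have := hx.sub hs
      simpa using this
    rw [← hx.tsum_sub hy]
    exact enorm_tsum_le_tsum_enorm
  · have hy : ¬ Summable y := fun hy => hx (by simpa using hs.add hy)
    rw [tsum_eq_zero_of_not_summable hx, tsum_eq_zero_of_not_summable hy]
    simp

section Intensity

variable {ι : Type} {p : ℕ}

/-- The total weight in the log-intensity of node `i` of the log-scale count of node `j` at
lag `h + 1`. -/
def coef (β₁ β₂ : Fin p → ℝ) (W : ι → ι → ℝ) (h : Fin p) (i j : ι) : ℝ≥0∞ :=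
  open Classical in ‖β₁ h‖ₑ * ‖W i j‖ₑ + ‖β₂ h‖ₑ * if j = i then 1 else 0

lemma tsum_coef_mul (β₁ β₂ : Fin p → ℝ) (W : ι → ι → ℝ) (h : Fin p) (i : ι) (f : ι → ℝ≥0∞) :
    ∑' j, coef β₁ β₂ W h i j * f j = ‖β₁ h‖ₑ * ∑' j, ‖W i j‖ₑ * f j + ‖β₂ h‖ₑ * f i := by
  classical
  unfold coef
  simp_rw [add_mul]
  rw [ENNReal.tsum_add, ← ENNReal.tsum_mul_left]
  congr 1
  · exact tsum_congr fun j => mul_assoc _ _ _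
  · rw [tsum_eq_single i fun j hj => by simp [hj]]
    simp

lemma tsum_coef_le (β₁ β₂ : Fin p → ℝ) {W : ι → ι → ℝ} (hW : IsWeightMatrix W) (h : Fin p)
    (i : ι) : ∑' j, coef β₁ β₂ W h i j ≤ ‖β₁ h‖ₑ + ‖β₂ h‖ₑ := by
  have h1 := tsum_coef_mul β₁ β₂ W h i fun _ => 1
  simp only [mul_one] at h1
  rw [h1]
  gcongr
  refine mul_le_of_le_one_right' ?_
  simp_rw [Real.enorm_eq_ofReal_abs]
  rw [← ENNReal.ofReal_tsum_of_nonneg (fun j => abs_nonneg _) (hW i).1]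
  exact ENNReal.ofReal_le_one.2 (hW i).2

lemma sum_tsum_coef_le {β₁ β₂ : Fin p → ℝ} {W : ι → ι → ℝ} (hW : IsWeightMatrix W) (i : ι) :
    ∑ h, ∑' j, coef β₁ β₂ W h i j ≤ ENNReal.ofReal (∑ h, (|β₁ h| + |β₂ h|)) := by
  rw [ENNReal.ofReal_sum_of_nonneg fun h _ => by positivity]
  refine Finset.sum_le_sum fun h _ => ?_
  rw [ENNReal.ofReal_add (abs_nonneg _) (abs_nonneg _), ← Real.enorm_eq_ofReal_abs,
    ← Real.enorm_eq_ofReal_abs]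
  exact tsum_coef_le β₁ β₂ hW h i

variable {Ω : Type*} {β₀ : ℝ} {β₁ β₂ : Fin p → ℝ} {W : ι → ι → ℝ}

/-- Valid at every `ω`, whether or not the network series converge, thanks to
`enorm_tsum_sub_tsum_le`. -/
lemma enorm_logIntensity_sub_le (Y Y' : ℤ → Ω → ι → ℕ) (t : ℤ) (ω : Ω) (i : ι) :
    ‖logIntensity β₀ β₁ β₂ W Y t ω i - logIntensity β₀ β₁ β₂ W Y' t ω i‖ₑ
      ≤ ∑ h : Fin p, ∑' j, coef β₁ β₂ W h i j *
        ‖logCount (Y (t - ((h : ℕ) + 1)) ω j) - logCount (Y' (t - ((h : ℕ) + 1)) ω j)‖ₑ := by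
  have h1 : logIntensity β₀ β₁ β₂ W Y t ω i - logIntensity β₀ β₁ β₂ W Y' t ω i
      = ∑ h : Fin p, (β₁ h * (∑' j, W i j * logCount (Y (t - ((h : ℕ) + 1)) ω j)
            - ∑' j, W i j * logCount (Y' (t - ((h : ℕ) + 1)) ω j))
          + β₂ h * (logCount (Y (t - ((h : ℕ) + 1)) ω i)
            - logCount (Y' (t - ((h : ℕ) + 1)) ω i))) := by
    simp only [logIntensity, mul_sub, Finset.sum_add_distrib, Finset.sum_sub_distrib]
    ring
  rw [h1]
  refine (enorm_sum_le _ _).trans (Finset.sum_le_sum fun h _ => ?_)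
  rw [tsum_coef_mul]
  refine (enorm_add_le _ _).trans ?_
  rw [enorm_mul, enorm_mul]
  gcongr
  refine (enorm_tsum_sub_tsum_le _ _).trans (le_of_eq (tsum_congr fun j => ?_))
  rw [← mul_sub, enorm_mul]

/-- Comparison with the zero process turns the Lipschitz bound into a bound for `|ν - β₀|`. -/
lemma logIntensity_zero (t : ℤ) (ω : Ω) (i : ι) :
    logIntensity β₀ β₁ β₂ W (fun _ _ _ => 0) t ω i = β₀ := by
  simp [logIntensity]

lemma measurable_logIntensity [Countable ι] {m : MeasurableSpace Ω} {Y : ℤ → Ω → ι → ℕ} {t : ℤ}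
    (hY : ∀ s < t, Measurable[m] (Y s)) (i : ι) :
    Measurable[m] fun ω => logIntensity β₀ β₁ β₂ W Y t ω i := by
  have h1 : ∀ (h : Fin p) j, Measurable[m] fun ω => logCount (Y (t - ((h : ℕ) + 1)) ω j) :=
    fun h j => (measurable_of_countable logCount).comp
      ((measurable_pi_apply j).comp (hY _ (by omega)))
  unfold logIntensity
  refine (measurable_const.add (Finset.measurable_fun_sum _ fun h _ => ?_)).add
    (Finset.measurable_fun_sum _ fun h _ => ?_)
  · exact (Measurable.tsum fun j => (h1 h j).const_mul (W i j)).const_mul _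
  · exact (h1 h i).const_mul _

end Intensity

/-! ### Exponential moments of the log-intensity -/

/-- A form of Jensen's inequality for the exponential function and weights of total mass less
than one. -/
lemma ofReal_exp_le_of_weights {κ : Type*} {a : κ → ℝ≥0∞} {c δ s : ℝ} (hc0 : 0 ≤ c) (hc : c < 1)
    (hδ : 0 < δ) (ha : ∑' k, a k ≤ ENNReal.ofReal c) {x : κ → ℝ} (hs0 : 0 ≤ s)
    (hs : ENNReal.ofReal s ≤ ∑' k, a k * ENNReal.ofReal (x k)) :
    ENNReal.ofReal (Real.exp s) ≤ ENNReal.ofReal (Real.exp (δ * (1 - c))⁻¹)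
      + ENNReal.ofReal δ * ∑' k, a k * ENNReal.ofReal (Real.exp (x k)) := by
  have hδc : 0 < δ * (1 - c) := mul_pos hδ (by linarith)
  -- Summing tangent-line inequalities will give `(1 - c) s exp s ≤ T`, with `T` the weighted sum of
  -- exponentials. The factor `s` gained from the missing mass beats `δ⁻¹` once `s ≥ (δ (1 - c))⁻¹`;
  -- smaller `s` go into the constant.
  rcases le_total s (δ * (1 - c))⁻¹ with h | h
  · exact (ENNReal.ofReal_le_ofReal (Real.exp_le_exp.2 h)).trans le_self_add
  refine le_trans ?_ le_add_self
  set T := ∑' k, a k * ENNReal.ofReal (Real.exp (x k)) with hT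
  by_cases hTt : T = ∞
  · rw [hTt, ENNReal.mul_top (by simpa using hδ)]
    exact le_top
  -- The graph of `exp` lies above its tangent at `s`: `exp x ≥ exp s (1 + x - s)`.
  have htan : ∀ k, ENNReal.ofReal (Real.exp s) * ENNReal.ofReal (x k)
      ≤ ENNReal.ofReal (Real.exp (x k)) + ENNReal.ofReal (s * Real.exp s) := by
    intro k
    rw [← ENNReal.ofReal_mul (Real.exp_pos s).le, ← ENNReal.ofReal_add (Real.exp_pos _).le
      (mul_nonneg hs0 (Real.exp_pos s).le)]
    refine ENNReal.ofReal_le_ofReal ?_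
    have h1 := Real.add_one_le_exp (x k - s)
    have h2 : Real.exp (x k) = Real.exp s * Real.exp (x k - s) := by
      rw [← Real.exp_add]; congr 1; ring
    rw [h2]
    nlinarith [Real.exp_pos s]
  have hsum : ENNReal.ofReal (s * Real.exp s) ≤ T + ENNReal.ofReal (c * (s * Real.exp s)) := by
    calc ENNReal.ofReal (s * Real.exp s)
        = ENNReal.ofReal (Real.exp s) * ENNReal.ofReal s := by
          rw [mul_comm, ENNReal.ofReal_mul (Real.exp_pos s).le]
      _ ≤ ENNReal.ofReal (Real.exp s) * ∑' k, a k * ENNReal.ofReal (x k) := by gcongr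
      _ = ∑' k, a k * (ENNReal.ofReal (Real.exp s) * ENNReal.ofReal (x k)) := by
          rw [← ENNReal.tsum_mul_left]
          exact tsum_congr fun k => by ring
      _ ≤ ∑' k, (a k * ENNReal.ofReal (Real.exp (x k))
            + a k * ENNReal.ofReal (s * Real.exp s)) := by
          refine ENNReal.tsum_le_tsum fun k => ?_
          rw [← mul_add]
          gcongr
          exact htan k
      _ = T + (∑' k, a k) * ENNReal.ofReal (s * Real.exp s) := by
          rw [ENNReal.tsum_add, ENNReal.tsum_mul_right]
      _ ≤ T + ENNReal.ofReal (c * (s * Real.exp s)) := by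
          rw [ENNReal.ofReal_mul hc0]
          gcongr
  have hse : 0 ≤ s * Real.exp s := mul_nonneg hs0 (Real.exp_pos s).le
  rw [← ENNReal.ofReal_toReal hTt, ← ENNReal.ofReal_add ENNReal.toReal_nonneg
    (mul_nonneg hc0 hse), ENNReal.ofReal_le_ofReal_iff
    (add_nonneg ENNReal.toReal_nonneg (mul_nonneg hc0 hse))] at hsum
  rw [← ENNReal.ofReal_toReal hTt, ← ENNReal.ofReal_mul hδ.le]
  refine ENNReal.ofReal_le_ofReal ?_
  have h1 : 1 ≤ s * (δ * (1 - c)) := by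
    rwa [inv_le_iff_one_le_mul₀ hδc] at h
  calc Real.exp s ≤ s * (δ * (1 - c)) * Real.exp s := by
        nlinarith [Real.exp_pos s]
    _ = δ * (s * Real.exp s - c * (s * Real.exp s)) := by ring
    _ ≤ δ * T.toReal := by gcongr; linarith

/-- The additive constant in the exponential moment bound of order `n` for the log-intensity. -/
def intensityConst (β₀ c : ℝ) (n : ℕ) : ℝ :=
  Real.exp (n * |β₀|) * Real.exp ((2 * 2 ^ n * Real.exp (n * |β₀|))⁻¹ * (1 - c))⁻¹

/-- The bound for the moment of order `n` of the counts. -/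
def countConst (β₀ c : ℝ) (n : ℕ) : ℝ := 2 * (2 ^ n * intensityConst β₀ c n + (2 * n) ^ n + 1)

lemma intensityConst_nonneg (β₀ c : ℝ) (n : ℕ) : 0 ≤ intensityConst β₀ c n := by
  unfold intensityConst; positivity

lemma one_le_countConst (β₀ c : ℝ) (n : ℕ) : 1 ≤ countConst β₀ c n := by
  have := intensityConst_nonneg β₀ c n
  have h1 : 0 ≤ 2 ^ n * intensityConst β₀ c n + (2 * (n : ℝ)) ^ n := by positivity
  unfold countConst
  linarith

section

variable {ι : Type} {p : ℕ} {Ω : Type*} {β₀ : ℝ} {β₁ β₂ : Fin p → ℝ} {W : ι → ι → ℝ}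

lemma ofReal_exp_abs_logIntensity_le (hβ : ∑ h, (|β₁ h| + |β₂ h|) < 1) (hW : IsWeightMatrix W)
    (Y : ℤ → Ω → ι → ℕ) (t : ℤ) (ω : Ω) (i : ι) (n : ℕ) :
    ENNReal.ofReal (Real.exp (n * |logIntensity β₀ β₁ β₂ W Y t ω i|))
      ≤ ENNReal.ofReal (intensityConst β₀ (∑ h, (|β₁ h| + |β₂ h|)) n)
        + ENNReal.ofReal (2 * 2 ^ n)⁻¹ * ∑ h : Fin p, ∑' j, coef β₁ β₂ W h i j *
          ENNReal.ofReal ((1 + (Y (t - ((h : ℕ) + 1)) ω j : ℝ)) ^ n) := by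
  set c := ∑ h, (|β₁ h| + |β₂ h|) with hc
  set ν := logIntensity β₀ β₁ β₂ W Y t ω i
  set b := Real.exp (n * |β₀|) with hb
  have hb0 : 0 < b := Real.exp_pos _
  have hc0 : 0 ≤ c := Finset.sum_nonneg fun h _ => by positivity
  have hprod : ∀ f : Fin p × ι → ℝ≥0∞, ∑' k, f k = ∑ h, ∑' j, f (h, j) := fun f => by
    rw [ENNReal.tsum_prod', tsum_fintype]
  have hν : ENNReal.ofReal (n * |ν - β₀|) ≤ ∑' k : Fin p × ι, coef β₁ β₂ W k.1 i k.2 *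
      ENNReal.ofReal (n * logCount (Y (t - ((k.1 : ℕ) + 1)) ω k.2)) := by
    have h1 := enorm_logIntensity_sub_le (β₀ := β₀) (β₁ := β₁) (β₂ := β₂) (W := W) Y
      (fun _ _ _ => 0) t ω i
    rw [logIntensity_zero] at h1
    rw [hprod, ENNReal.ofReal_mul (by positivity), ← Real.enorm_eq_ofReal_abs]
    refine (mul_le_mul_right h1 _).trans (le_of_eq ?_)
    rw [Finset.mul_sum]
    refine Finset.sum_congr rfl fun h _ => ?_
    rw [← ENNReal.tsum_mul_left]
    refine tsum_congr fun j => ?_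
    rw [ENNReal.ofReal_mul (by positivity), ← Real.enorm_of_nonneg (logCount_nonneg _)]
    simp only [logCount, Nat.cast_zero, add_zero, Real.log_one, sub_zero]
    ring
  -- This `δ` absorbs the factor `b = exp (n |β₀|)` and leaves the weight `(2 * 2^n)⁻¹`, which
  -- becomes 1/2 after the factor `2^n` of the Poisson moment bound.
  have hδ : 0 < (2 * 2 ^ n * b)⁻¹ := by positivity
  have key := ofReal_exp_le_of_weights hc0 hβ hδ
    (by rw [hprod]; exact sum_tsum_coef_le hW i) (by positivity) hν
  rw [hprod] at key
  have h2 : n * |ν| ≤ n * |β₀| + n * |ν - β₀| := by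
    rw [← mul_add]
    gcongr
    have := abs_add_le β₀ (ν - β₀)
    rwa [add_sub_cancel] at this
  have h3 : ENNReal.ofReal (Real.exp (n * |ν|))
      ≤ ENNReal.ofReal b * ENNReal.ofReal (Real.exp (n * |ν - β₀|)) := by
    rw [← ENNReal.ofReal_mul hb0.le, hb, ← Real.exp_add]
    exact ENNReal.ofReal_le_ofReal (Real.exp_le_exp.2 h2)
  refine h3.trans ((mul_le_mul_right key _).trans (le_of_eq ?_))
  rw [mul_add, ← ENNReal.ofReal_mul hb0.le, ← mul_assoc, ← ENNReal.ofReal_mul hb0.le]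
  congr 2
  · congr 1
    field_simp
  · refine Finset.sum_congr rfl fun h _ => tsum_congr fun j => ?_
    rw [Real.exp_nat_mul, exp_logCount]

variable [MeasurableSpace Ω] {P : Measure Ω}

lemma lintegral_sum_tsum_coef_le [Countable ι] {c B : ℝ≥0∞}
    (hc : ∀ i, ∑ h, ∑' j, coef β₁ β₂ W h i j ≤ c) {f : Fin p → ι → Ω → ℝ≥0∞}
    (hf : ∀ h j, Measurable (f h j)) (hB : ∀ h j, ∫⁻ ω, f h j ω ∂P ≤ B) (i : ι) :
    ∫⁻ ω, ∑ h, ∑' j, coef β₁ β₂ W h i j * f h j ω ∂P ≤ c * B := by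
  rw [lintegral_finsetSum _ fun h _ => Measurable.tsum fun j => (hf h j).const_mul _]
  calc ∑ h, ∫⁻ ω, ∑' j, coef β₁ β₂ W h i j * f h j ω ∂P
      = ∑ h, ∑' j, coef β₁ β₂ W h i j * ∫⁻ ω, f h j ω ∂P := by
        refine Finset.sum_congr rfl fun h _ => ?_
        rw [lintegral_tsum fun j => ((hf h j).const_mul _).aemeasurable]
        exact tsum_congr fun j => lintegral_const_mul _ (hf h j)
    _ ≤ ∑ h, ∑' j, coef β₁ β₂ W h i j * B := by
        gcongr with h _ j
        exact hB h j
    _ ≤ c * B := by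
        simp_rw [ENNReal.tsum_mul_right, ← Finset.sum_mul]
        gcongr
        exact hc i

lemma lintegral_exp_abs_logIntensity_le [Countable ι] [IsProbabilityMeasure P]
    (hβ : ∑ h, (|β₁ h| + |β₂ h|) < 1) (hW : IsWeightMatrix W) {Y : ℤ → Ω → ι → ℕ}
    (hY : ∀ t, Measurable (Y t)) {n : ℕ} {B : ℝ} (hB0 : 0 ≤ B)
    (hB : ∀ t i, ∫⁻ ω, ENNReal.ofReal ((1 + (Y t ω i : ℝ)) ^ n) ∂P ≤ ENNReal.ofReal B)
    (t : ℤ) (i : ι) :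
    ∫⁻ ω, ENNReal.ofReal (Real.exp (n * |logIntensity β₀ β₁ β₂ W Y t ω i|)) ∂P
      ≤ ENNReal.ofReal (intensityConst β₀ (∑ h, (|β₁ h| + |β₂ h|)) n + (2 * 2 ^ n)⁻¹ * B) := by
  have hf : ∀ (h : Fin p) j, Measurable fun ω =>
      ENNReal.ofReal ((1 + (Y (t - ((h : ℕ) + 1)) ω j : ℝ)) ^ n) := fun h j =>
    (measurable_of_countable fun k : ℕ => ENNReal.ofReal ((1 + (k : ℝ)) ^ n)).comp
      ((measurable_pi_apply j).comp (hY _))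
  refine (lintegral_mono fun ω => ofReal_exp_abs_logIntensity_le hβ hW Y t ω i n).trans ?_
  rw [lintegral_add_left measurable_const, lintegral_const, measure_univ, mul_one,
    lintegral_const_mul _ (Finset.measurable_fun_sum _ fun h _ =>
      Measurable.tsum fun j => (hf h j).const_mul _),
    ENNReal.ofReal_add (intensityConst_nonneg _ _ _) (by positivity),
    ENNReal.ofReal_mul (by positivity)]
  gcongr
  refine (lintegral_sum_tsum_coef_le (fun i => sum_tsum_coef_le hW i) hf
    (fun h j => hB _ j) i).trans ?_
  exact mul_le_of_le_one_left' (ENNReal.ofReal_le_one.2 hβ.le)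

end

/-! ### Picard iteration -/

section Picard

variable {Ω : Type*} {ι : Type} {p : ℕ}

/-- The σ-algebra of the noise before time `t`. -/
abbrev noiseBefore (U : ℤ → ℕ → Ω → ι → ℝ) (t : ℤ) : MeasurableSpace Ω :=
  ⨆ s, ⨆ (_ : s < t), noiseAt U s

lemma measurable_noiseBefore (U : ℤ → ℕ → Ω → ι → ℝ) {s t : ℤ} (h : s < t) (l : ℕ) :
    Measurable[noiseBefore U t] (U s l) :=
  (measurable_noiseAt U s l).mono (le_iSup₂_of_le s h le_rfl) le_rfl

lemma noiseBefore_le {mΩ : MeasurableSpace Ω} {P : Measure Ω} {C : Measure (ι → ℝ)}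
    {U : ℤ → ℕ → Ω → ι → ℝ} (hU : IsCopulaSample P C U) (t : ℤ) : noiseBefore U t ≤ mΩ :=
  iSup₂_le fun s _ => noiseAt_le hU s

lemma indep_noiseBefore {mΩ : MeasurableSpace Ω} {P : Measure Ω} {C : Measure (ι → ℝ)}
    {U : ℤ → ℕ → Ω → ι → ℝ} (hU : IsCopulaSample P C U) (t : ℤ) :
    Indep (noiseAt U t) (noiseBefore U t) P := by
  have h := indep_iSup_of_disjoint
    (m := fun q : ℤ × ℕ => MeasurableSpace.comap (U q.1 q.2) inferInstance)
    (fun q => (hU.measurable q.1 q.2).comap_le) hU.indep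
    (S := {q | q.1 = t}) (T := {q | q.1 < t})
    (Set.disjoint_left.2 fun q h1 h2 => by
      simp only [Set.mem_ofPred_eq] at h1 h2
      omega)
  refine indep_of_indep_of_le_left (indep_of_indep_of_le_right h ?_) ?_
  · exact iSup₂_le fun s hs => iSup_le fun l => le_iSup₂_of_le (s, l) hs le_rfl
  · exact iSup_le fun l => le_iSup₂_of_le (t, l) rfl le_rfl

/-- The eventual value of a sequence of natural numbers, and `0` if there is none. -/
def eventualValue (x : ℕ → ℕ) : ℕ := sSup {k | ∀ᶠ n in atTop, x n = k}

lemma eventualValue_eq {x : ℕ → ℕ} {k : ℕ} (h : ∀ᶠ n in atTop, x n = k) : eventualValue x = k := by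
  have : {k | ∀ᶠ n in atTop, x n = k} = {k} := by
    ext j
    simp only [Set.mem_ofPred_eq, Set.mem_singleton_iff]
    constructor
    · intro hj
      obtain ⟨n, hn⟩ := (hj.and h).exists
      exact hn.1.symm.trans hn.2
    · rintro rfl
      exact h
  rw [eventualValue, this, csSup_singleton]

lemma measurable_eventualValue : Measurable eventualValue := by
  unfold eventualValue
  refine measurable_sSup_nat fun k => ?_
  simp_rw [eventually_atTop]
  have : {x : ℕ → ℕ | ∃ a, ∀ b ≥ a, x b = k} = ⋃ a, ⋂ b, ⋂ (_ : b ≥ a), {x | x b = k} := by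
    ext x; simp
  rw [this]
  exact MeasurableSet.iUnion fun a => MeasurableSet.iInter fun b => MeasurableSet.iInter fun _ =>
    measurableSet_eq_fun (measurable_pi_apply b) measurable_const

/-- The iterates `Y⁽⁰⁾ = 0`, `Y⁽ⁿ⁺¹⁾_{i,t} = N_{i,t}(exp ν_{i,t}(Y⁽ⁿ⁾))`. -/
def picard (U : ℤ → ℕ → Ω → ι → ℝ) (β₀ : ℝ) (β₁ β₂ : Fin p → ℝ) (W : ι → ι → ℝ) :
    ℕ → ℤ → Ω → ι → ℕ
  | 0 => fun _ _ _ => 0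
  | n + 1 => fun t ω i => copulaPoisson U t ω i
      (Real.exp (logIntensity β₀ β₁ β₂ W (picard U β₀ β₁ β₂ W n) t ω i))

/-- The limit of the Picard iterates. -/
def picardLimit (U : ℤ → ℕ → Ω → ι → ℝ) (β₀ : ℝ) (β₁ β₂ : Fin p → ℝ) (W : ι → ι → ℝ)
    (t : ℤ) (ω : Ω) (i : ι) : ℕ :=
  eventualValue fun n => picard U β₀ β₁ β₂ W n t ω i

variable {U : ℤ → ℕ → Ω → ι → ℝ} {β₀ : ℝ} {β₁ β₂ : Fin p → ℝ} {W : ι → ι → ℝ}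

lemma measurable_copulaPoisson {m : MeasurableSpace Ω} {t : ℤ} (hU : ∀ l, Measurable[m] (U t l))
    {a : Ω → ℝ} (ha : Measurable[m] a) (i : ι) :
    Measurable[m] fun ω => copulaPoisson U t ω i (a ω) := by
  refine measurable_arrivals.comp (f := fun ω => ((fun l => -Real.log (U t l ω i)), a ω)) ?_
  refine Measurable.prodMk (measurable_pi_lambda _ fun l => ?_) ha
  exact (Real.measurable_log.comp ((measurable_pi_apply i).comp (hU l))).neg

lemma measurable_picard [Countable ι] {m : MeasurableSpace Ω} (n : ℕ) {t : ℤ}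
    (hU : ∀ s ≤ t, ∀ l, Measurable[m] (U s l)) : Measurable[m] (picard U β₀ β₁ β₂ W n t) := by
  induction n generalizing t with
  | zero => exact measurable_const
  | succ n ih =>
    refine measurable_pi_lambda _ fun i => ?_
    refine measurable_copulaPoisson (hU t le_rfl) (Real.measurable_exp.comp ?_) i
    exact measurable_logIntensity (fun s hs => ih fun r hr => hU r (hr.trans hs.le)) i

/-- The σ-algebra is left free: causality is used for the noise before a time and for the past of
another solution, plain measurability on `Ω` and on the canonical space of noise paths. -/
lemma measurable_picardLimit [Countable ι] {m : MeasurableSpace Ω} {t : ℤ}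
    (hU : ∀ s ≤ t, ∀ l, Measurable[m] (U s l)) : Measurable[m] (picardLimit U β₀ β₁ β₂ W t) :=
  measurable_pi_lambda _ fun i => measurable_eventualValue.comp <| measurable_pi_lambda _ fun n =>
    (measurable_pi_apply i).comp (measurable_picard n hU)

lemma IsCopulaSample.measurable_picard [Countable ι] [MeasurableSpace Ω] {P : Measure Ω}
    {C : Measure (ι → ℝ)} (hU : IsCopulaSample P C U) (n : ℕ) (t : ℤ) :
    Measurable (picard U β₀ β₁ β₂ W n t) :=
  PNAR.measurable_picard n fun s _ l => hU.measurable s l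

lemma IsCopulaSample.measurable_picardLimit [Countable ι] [MeasurableSpace Ω] {P : Measure Ω}
    {C : Measure (ι → ℝ)} (hU : IsCopulaSample P C U) (t : ℤ) :
    Measurable (picardLimit U β₀ β₁ β₂ W t) :=
  PNAR.measurable_picardLimit fun s _ l => hU.measurable s l

end Picard

section Contraction

variable {Ω : Type*} {m mΩ : MeasurableSpace Ω} {ι : Type} [Countable ι] {p : ℕ} {P : Measure Ω}
  [IsProbabilityMeasure P] {C : Measure (ι → ℝ)} {U : ℤ → ℕ → Ω → ι → ℝ} {β₀ : ℝ}
  {β₁ β₂ : Fin p → ℝ} {W : ι → ι → ℝ}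

lemma measurable_enorm_logCount_sub {a b : Ω → ℕ} (ha : Measurable a) (hb : Measurable b) :
    Measurable fun ω => ‖logCount (a ω) - logCount (b ω)‖ₑ :=
  (((measurable_of_countable logCount).comp ha).sub
    ((measurable_of_countable logCount).comp hb)).enorm

/-- One step of the model contracts the mean distance of the log-scale counts. -/
lemma setLIntegral_step_le (hC : IsCopula C) (hU : IsCopulaSample P C U) (hm : m ≤ mΩ) {t : ℤ}
    (hi : Indep (noiseAt U t) m P) {Y Y' : ℤ → Ω → ι → ℕ} (hY : ∀ s < t, Measurable[m] (Y s))
    (hY' : ∀ s < t, Measurable[m] (Y' s)) {A : Set Ω} (hA : MeasurableSet[m] A) (i : ι) :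
    ∫⁻ ω in A, ‖logCount (copulaPoisson U t ω i (Real.exp (logIntensity β₀ β₁ β₂ W Y t ω i)))
        - logCount (copulaPoisson U t ω i (Real.exp (logIntensity β₀ β₁ β₂ W Y' t ω i)))‖ₑ ∂P
      ≤ ∑ h : Fin p, ∑' j, coef β₁ β₂ W h i j * ∫⁻ ω in A,
        ‖logCount (Y (t - ((h : ℕ) + 1)) ω j) - logCount (Y' (t - ((h : ℕ) + 1)) ω j)‖ₑ ∂P := by
  have hf : ∀ (h : Fin p) j, Measurable fun ω =>
      ‖logCount (Y (t - ((h : ℕ) + 1)) ω j) - logCount (Y' (t - ((h : ℕ) + 1)) ω j)‖ₑ :=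
    fun h j => measurable_enorm_logCount_sub
      ((measurable_pi_apply j).comp ((hY _ (by omega)).mono hm le_rfl))
      ((measurable_pi_apply j).comp ((hY' _ (by omega)).mono hm le_rfl))
  refine (setLIntegral_logCount_sub_le hC hU hm hi i (measurable_logIntensity hY i)
    (measurable_logIntensity hY' i) hA).trans ?_
  refine (lintegral_mono fun ω => enorm_logIntensity_sub_le Y Y' t ω i).trans (le_of_eq ?_)
  rw [lintegral_finsetSum _ fun h _ => Measurable.tsum fun j => (hf h j).const_mul _]
  refine Finset.sum_congr rfl fun h _ => ?_
  rw [lintegral_tsum fun j => ((hf h j).const_mul _).aemeasurable]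
  exact tsum_congr fun j => lintegral_const_mul _ (hf h j)

/-- The rows of `coef`, summed over all lags, have mass at most `c`, so a bound uniform over times
and nodes shrinks by the factor `c`. -/
lemma lintegral_step_le (hC : IsCopula C) (hU : IsCopulaSample P C U) (hW : IsWeightMatrix W)
    {Y Y' : ℤ → Ω → ι → ℕ} (t : ℤ) (hY : ∀ s < t, Measurable[noiseBefore U t] (Y s))
    (hY' : ∀ s < t, Measurable[noiseBefore U t] (Y' s)) {B : ℝ≥0∞}
    (hB : ∀ s j, ∫⁻ ω, ‖logCount (Y s ω j) - logCount (Y' s ω j)‖ₑ ∂P ≤ B) (i : ι) :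
    ∫⁻ ω, ‖logCount (copulaPoisson U t ω i (Real.exp (logIntensity β₀ β₁ β₂ W Y t ω i)))
        - logCount (copulaPoisson U t ω i (Real.exp (logIntensity β₀ β₁ β₂ W Y' t ω i)))‖ₑ ∂P
      ≤ ENNReal.ofReal (∑ h, (|β₁ h| + |β₂ h|)) * B := by
  have h1 := setLIntegral_step_le (β₀ := β₀) (β₁ := β₁) (β₂ := β₂) (W := W) hC hU
    (noiseBefore_le hU t) (indep_noiseBefore hU t) hY hY' (A := Set.univ) MeasurableSet.univ i
  simp only [Measure.restrict_univ] at h1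
  refine h1.trans ?_
  calc _ ≤ ∑ h : Fin p, ∑' j, coef β₁ β₂ W h i j * B := by
        gcongr with h _ j
        exact hB _ j
    _ ≤ _ := by
        simp_rw [ENNReal.tsum_mul_right, ← Finset.sum_mul]
        gcongr
        exact sum_tsum_coef_le hW i

lemma measurable_picard_noiseBefore (n : ℕ) {s t : ℤ} (h : s < t) :
    Measurable[noiseBefore U t] (picard U β₀ β₁ β₂ W n s) :=
  measurable_picard n fun _ hr l => measurable_noiseBefore U (hr.trans_lt h) l

lemma measurable_picardLimit_noiseBefore {s t : ℤ} (h : s < t) :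
    Measurable[noiseBefore U t] (picardLimit U β₀ β₁ β₂ W s) :=
  measurable_picardLimit fun _ hr l => measurable_noiseBefore U (hr.trans_lt h) l

/-! ### Moments -/

/-- Induction on the iterate: `countConst` is chosen so that one step of the model does not increase
it, and it is at least 1, the value for the zero process. -/
lemma lintegral_one_add_picard_pow_le (hβ : ∑ h, (|β₁ h| + |β₂ h|) < 1) (hW : IsWeightMatrix W)
    (hC : IsCopula C) (hU : IsCopulaSample P C U) (n k : ℕ) (t : ℤ) (i : ι) :
    ∫⁻ ω, ENNReal.ofReal ((1 + (picard U β₀ β₁ β₂ W k t ω i : ℝ)) ^ n) ∂P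
      ≤ ENNReal.ofReal (countConst β₀ (∑ h, (|β₁ h| + |β₂ h|)) n) := by
  set c := ∑ h, (|β₁ h| + |β₂ h|)
  have hK := intensityConst_nonneg β₀ c n
  have hB := one_le_countConst β₀ c n
  induction k generalizing t i with
  | zero => simpa [picard] using hB
  | succ k ih =>
    have hmeas : Measurable fun ω => logIntensity β₀ β₁ β₂ W (picard U β₀ β₁ β₂ W k) t ω i :=
      measurable_logIntensity (fun s _ => hU.measurable_picard k s) i
    refine (lintegral_one_add_copulaPoisson_pow_le hC hU (noiseBefore_le hU t)
      (indep_noiseBefore hU t) i (measurable_logIntensity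
        (fun s hs => measurable_picard_noiseBefore k hs) i) n).trans ?_
    calc ∫⁻ ω, ENNReal.ofReal (2 ^ n *
            Real.exp (logIntensity β₀ β₁ β₂ W (picard U β₀ β₁ β₂ W k) t ω i) ^ n
              + (2 * n) ^ n) ∂P
        ≤ ∫⁻ ω, (ENNReal.ofReal (2 ^ n) * ENNReal.ofReal (Real.exp (n *
            |logIntensity β₀ β₁ β₂ W (picard U β₀ β₁ β₂ W k) t ω i|))
              + ENNReal.ofReal ((2 * n) ^ n)) ∂P := by
          refine lintegral_mono fun ω => ?_
          rw [← ENNReal.ofReal_mul (by positivity), ← ENNReal.ofReal_add (by positivity)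
            (by positivity), ← Real.exp_nat_mul]
          refine ENNReal.ofReal_le_ofReal ?_
          gcongr
          exact le_abs_self _
      _ ≤ ENNReal.ofReal (2 ^ n) * ENNReal.ofReal (intensityConst β₀ c n
            + (2 * 2 ^ n)⁻¹ * countConst β₀ c n) + ENNReal.ofReal ((2 * n) ^ n) := by
          rw [lintegral_add_right _ measurable_const, lintegral_const_mul _ (by fun_prop),
            lintegral_const, measure_univ, mul_one]
          gcongr
          exact lintegral_exp_abs_logIntensity_le hβ hW (fun t => hU.measurable_picard k t)
            (by linarith) (fun t i => ih t i) t i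
      _ ≤ ENNReal.ofReal (countConst β₀ c n) := by
          rw [← ENNReal.ofReal_mul (by positivity), ← ENNReal.ofReal_add (by positivity)
            (by positivity)]
          refine ENNReal.ofReal_le_ofReal ?_
          -- The old bound `B` returns as `B / 2`, and `B / 2` was defined as the remaining
          -- constants plus 1.
          have h1 : (2 : ℝ) ^ n * (intensityConst β₀ c n + (2 * 2 ^ n)⁻¹ * countConst β₀ c n)
              = 2 ^ n * intensityConst β₀ c n + countConst β₀ c n / 2 := by
            field_simp
          rw [h1]
          unfold countConst
          linarith

/-! ### Convergence of the Picard iterates -/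

lemma lintegral_picard_succ_sub_le (hβ : ∑ h, (|β₁ h| + |β₂ h|) < 1) (hW : IsWeightMatrix W)
    (hC : IsCopula C) (hU : IsCopulaSample P C U) (n : ℕ) (t : ℤ) (i : ι) :
    ∫⁻ ω, ‖logCount (picard U β₀ β₁ β₂ W n t ω i)
        - logCount (picard U β₀ β₁ β₂ W (n + 1) t ω i)‖ₑ ∂P
      ≤ ENNReal.ofReal (∑ h, (|β₁ h| + |β₂ h|)) ^ n *
        ENNReal.ofReal (countConst β₀ (∑ h, (|β₁ h| + |β₂ h|)) 1) := by
  induction n generalizing t i with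
  | zero =>
    rw [pow_zero, one_mul]
    refine le_trans (lintegral_mono fun ω => ?_)
      (lintegral_one_add_picard_pow_le hβ hW hC hU 1 1 t i)
    rw [← enorm_neg, neg_sub]
    have h0 : logCount (picard U β₀ β₁ β₂ W 0 t ω i) = 0 := by simp [picard, logCount]
    rw [h0, sub_zero, Real.enorm_of_nonneg (logCount_nonneg _), pow_one]
    refine ENNReal.ofReal_le_ofReal ?_
    have := logCount_le (picard U β₀ β₁ β₂ W 1 t ω i)
    simp only [zero_add]
    linarith
  | succ n ih =>
    rw [pow_succ', mul_assoc]
    exact lintegral_step_le hC hU hW t (fun s hs => measurable_picard_noiseBefore n hs)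
      (fun s hs => measurable_picard_noiseBefore (n + 1) hs) (fun s j => ih s j) i

/-- Finite total variation makes the log-counts converge; then the counts themselves converge, and a
convergent sequence of integers is eventually constant. -/
lemma eventually_eq_eventualValue {x : ℕ → ℕ}
    (h : ∑' n, ‖logCount (x n) - logCount (x (n + 1))‖ₑ ≠ ∞) :
    ∀ᶠ n in atTop, x n = eventualValue x := by
  have hcau : CauchySeq fun n => logCount (x n) :=
    cauchySeq_of_edist_le_of_tsum_ne_top _ (fun n => by rw [edist_eq_enorm_sub]) h
  obtain ⟨L, hL⟩ := cauchySeq_tendsto_of_complete hcau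
  have h1 : Tendsto (fun n => Real.exp (logCount (x n))) atTop (𝓝 (Real.exp L)) :=
    (Real.continuous_exp.tendsto L).comp hL
  simp_rw [exp_logCount] at h1
  obtain ⟨N, hN⟩ := Metric.cauchySeq_iff'.1 h1.cauchySeq 1 one_pos
  have h2 : ∀ᶠ n in atTop, x n = x N := by
    filter_upwards [eventually_ge_atTop N] with n hn
    have h3 := hN n hn
    rw [Real.dist_eq, add_sub_add_left_eq_sub, abs_lt] at h3
    have h4 : (x n : ℝ) < x N + 1 := by linarith [h3.2]
    have h5 : (x N : ℝ) < x n + 1 := by linarith [h3.1]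
    have h6 : x n < x N + 1 := by exact_mod_cast h4
    have h7 : x N < x n + 1 := by exact_mod_cast h5
    omega
  rwa [eventualValue_eq h2]

/-- The expected increments decay geometrically, so their sum is integrable and almost surely finite
at each of the countably many nodes and times. -/
lemma ae_eventually_picard_eq (hβ : ∑ h, (|β₁ h| + |β₂ h|) < 1) (hW : IsWeightMatrix W)
    (hC : IsCopula C) (hU : IsCopulaSample P C U) :
    ∀ᵐ ω ∂P, ∀ t i, ∀ᶠ n in atTop,
      picard U β₀ β₁ β₂ W n t ω i = picardLimit U β₀ β₁ β₂ W t ω i := by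
  refine ae_all_iff.2 fun t => ae_all_iff.2 fun i => ?_
  have hmeas : ∀ n, Measurable fun ω => ‖logCount (picard U β₀ β₁ β₂ W n t ω i)
      - logCount (picard U β₀ β₁ β₂ W (n + 1) t ω i)‖ₑ := fun n =>
    measurable_enorm_logCount_sub ((measurable_pi_apply i).comp (hU.measurable_picard n t))
      ((measurable_pi_apply i).comp (hU.measurable_picard (n + 1) t))
  have hfin : ∫⁻ ω, ∑' n, ‖logCount (picard U β₀ β₁ β₂ W n t ω i)
      - logCount (picard U β₀ β₁ β₂ W (n + 1) t ω i)‖ₑ ∂P ≠ ∞ := by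
    rw [lintegral_tsum fun n => (hmeas n).aemeasurable]
    refine ne_top_of_le_ne_top ?_
      (ENNReal.tsum_le_tsum fun n => lintegral_picard_succ_sub_le hβ hW hC hU n t i)
    rw [ENNReal.tsum_mul_right, ENNReal.tsum_geometric]
    refine ENNReal.mul_ne_top (ENNReal.inv_ne_top.2 ?_) ENNReal.ofReal_ne_top
    exact (tsub_pos_of_lt (ENNReal.ofReal_lt_one.2 hβ)).ne'
  filter_upwards [ae_lt_top (Measurable.tsum hmeas) hfin] with ω h
  exact eventually_eq_eventualValue h.ne

lemma lintegral_picard_sub_picardLimit_le (hβ : ∑ h, (|β₁ h| + |β₂ h|) < 1)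
    (hW : IsWeightMatrix W) (hC : IsCopula C) (hU : IsCopulaSample P C U) (n : ℕ) (t : ℤ) (i : ι) :
    ∫⁻ ω, ‖logCount (picard U β₀ β₁ β₂ W n t ω i)
        - logCount (picardLimit U β₀ β₁ β₂ W t ω i)‖ₑ ∂P
      ≤ ENNReal.ofReal (∑ h, (|β₁ h| + |β₂ h|)) ^ n *
        ((1 - ENNReal.ofReal (∑ h, (|β₁ h| + |β₂ h|)))⁻¹ *
          ENNReal.ofReal (countConst β₀ (∑ h, (|β₁ h| + |β₂ h|)) 1)) := by
  have hmeas : ∀ n, Measurable fun ω => ‖logCount (picard U β₀ β₁ β₂ W n t ω i)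
      - logCount (picard U β₀ β₁ β₂ W (n + 1) t ω i)‖ₑ := fun n =>
    measurable_enorm_logCount_sub ((measurable_pi_apply i).comp (hU.measurable_picard n t))
      ((measurable_pi_apply i).comp (hU.measurable_picard (n + 1) t))
  calc _ ≤ ∫⁻ ω, ∑' k, ‖logCount (picard U β₀ β₁ β₂ W (n + k) t ω i)
        - logCount (picard U β₀ β₁ β₂ W (n + k + 1) t ω i)‖ₑ ∂P := by
        refine lintegral_mono_ae ?_
        filter_upwards [ae_eventually_picard_eq (β₀ := β₀) hβ hW hC hU] with ω h
        have hlim : Tendsto (fun n => logCount (picard U β₀ β₁ β₂ W n t ω i)) atTop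
            (𝓝 (logCount (picardLimit U β₀ β₁ β₂ W t ω i))) :=
          tendsto_const_nhds.congr' ((h t i).mono fun n hn => by simp only [hn])
        rw [← edist_eq_enorm_sub]
        exact edist_le_tsum_of_edist_le_of_tendsto
          (fun n => ‖logCount (picard U β₀ β₁ β₂ W n t ω i)
            - logCount (picard U β₀ β₁ β₂ W (n + 1) t ω i)‖ₑ)
          (fun n => by rw [edist_eq_enorm_sub]) hlim n
    _ ≤ ∑' k, ENNReal.ofReal (∑ h, (|β₁ h| + |β₂ h|)) ^ (n + k) *
        ENNReal.ofReal (countConst β₀ (∑ h, (|β₁ h| + |β₂ h|)) 1) := by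
        rw [lintegral_tsum fun k => (hmeas (n + k)).aemeasurable]
        exact ENNReal.tsum_le_tsum fun k => lintegral_picard_succ_sub_le hβ hW hC hU (n + k) t i
    _ = _ := by
        simp_rw [pow_add]
        rw [ENNReal.tsum_mul_right, ENNReal.tsum_mul_left, ENNReal.tsum_geometric, mul_assoc]

/-- No pointwise passage to the limit inside the network series is needed: iterate `n + 1` lies
within `c^(n+1) K` in mean both of the limit and of the image of the limit under the model, so these
two agree. -/
lemma ae_picardLimit_eq (hβ : ∑ h, (|β₁ h| + |β₂ h|) < 1)
    (hW : IsWeightMatrix W) (hC : IsCopula C) (hU : IsCopulaSample P C U) (t : ℤ) :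
    ∀ᵐ ω ∂P, ∀ i, picardLimit U β₀ β₁ β₂ W t ω i = copulaPoisson U t ω i
      (Real.exp (logIntensity β₀ β₁ β₂ W (picardLimit U β₀ β₁ β₂ W) t ω i)) := by
  refine ae_all_iff.2 fun i => ?_
  set c := ENNReal.ofReal (∑ h, (|β₁ h| + |β₂ h|)) with hc
  set K := (1 - c)⁻¹ * ENNReal.ofReal (countConst β₀ (∑ h, (|β₁ h| + |β₂ h|)) 1) with hK
  have hc1 : c < 1 := ENNReal.ofReal_lt_one.2 hβ
  have hKt : K ≠ ∞ :=
    ENNReal.mul_ne_top (ENNReal.inv_ne_top.2 (tsub_pos_of_lt hc1).ne') ENNReal.ofReal_ne_top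
  set Y := picardLimit U β₀ β₁ β₂ W with hY
  set Z : Ω → ℕ := fun ω => copulaPoisson U t ω i (Real.exp (logIntensity β₀ β₁ β₂ W Y t ω i))
    with hZ
  have hZm : Measurable Z := measurable_copulaPoisson (hU.measurable t)
    (Real.measurable_exp.comp
      (measurable_logIntensity (fun s _ => hU.measurable_picardLimit s) i)) i
  have hYm : Measurable fun ω => Y t ω i :=
    (measurable_pi_apply i).comp (hU.measurable_picardLimit t)
  have hbound : ∀ n : ℕ, ∫⁻ ω, ‖logCount (Y t ω i) - logCount (Z ω)‖ₑ ∂P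
      ≤ c ^ (n + 1) * (K + K) := by
    intro n
    have hPm : Measurable fun ω => picard U β₀ β₁ β₂ W (n + 1) t ω i :=
      (measurable_pi_apply i).comp (hU.measurable_picard (n + 1) t)
    have h1 := lintegral_picard_sub_picardLimit_le (β₀ := β₀) hβ hW hC hU (n + 1) t i
    have h2 := lintegral_step_le (β₀ := β₀) (β₁ := β₁) (β₂ := β₂) (W := W) hC hU hW t
      (fun s hs => measurable_picard_noiseBefore n hs)
      (fun s hs => measurable_picardLimit_noiseBefore hs)
      (fun s j => lintegral_picard_sub_picardLimit_le (β₀ := β₀) hβ hW hC hU n s j) i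
    rw [← mul_assoc, ← pow_succ'] at h2
    calc ∫⁻ ω, ‖logCount (Y t ω i) - logCount (Z ω)‖ₑ ∂P
        ≤ ∫⁻ ω, (‖logCount (picard U β₀ β₁ β₂ W (n + 1) t ω i) - logCount (Y t ω i)‖ₑ
          + ‖logCount (picard U β₀ β₁ β₂ W (n + 1) t ω i) - logCount (Z ω)‖ₑ) ∂P := by
          refine lintegral_mono fun ω => ?_
          simp_rw [← edist_eq_enorm_sub]
          exact edist_triangle_left _ _ _
      _ ≤ c ^ (n + 1) * K + c ^ (n + 1) * K := by
          rw [lintegral_add_left (measurable_enorm_logCount_sub hPm hYm)]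
          exact add_le_add h1 h2
      _ = _ := by rw [mul_add]
  have hzero : ∫⁻ ω, ‖logCount (Y t ω i) - logCount (Z ω)‖ₑ ∂P = 0 := by
    have ht : Tendsto (fun n : ℕ => c ^ (n + 1) * (K + K)) atTop (𝓝 (0 * (K + K))) :=
      ENNReal.Tendsto.mul_const
        ((ENNReal.tendsto_pow_atTop_nhds_zero_of_lt_one hc1).comp (tendsto_add_atTop_nat 1))
        (Or.inr (ENNReal.add_ne_top.2 ⟨hKt, hKt⟩))
    rw [zero_mul] at ht
    exact le_antisymm (ge_of_tendsto' ht hbound) zero_le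
  rw [lintegral_eq_zero_iff (measurable_enorm_logCount_sub hYm hZm)] at hzero
  filter_upwards [hzero] with ω h
  refine logCount_injective (sub_eq_zero.1 ?_)
  simpa using h

/-- Fatou's lemma, applied to the uniform bound for the iterates. -/
lemma lintegral_one_add_picardLimit_pow_le (hβ : ∑ h, (|β₁ h| + |β₂ h|) < 1)
    (hW : IsWeightMatrix W) (hC : IsCopula C) (hU : IsCopulaSample P C U) (n : ℕ) (t : ℤ) (i : ι) :
    ∫⁻ ω, ENNReal.ofReal ((1 + (picardLimit U β₀ β₁ β₂ W t ω i : ℝ)) ^ n) ∂P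
      ≤ ENNReal.ofReal (countConst β₀ (∑ h, (|β₁ h| + |β₂ h|)) n) := by
  have hmeas : ∀ k, Measurable fun ω =>
      ENNReal.ofReal ((1 + (picard U β₀ β₁ β₂ W k t ω i : ℝ)) ^ n) := fun k =>
    (measurable_of_countable fun k : ℕ => ENNReal.ofReal ((1 + (k : ℝ)) ^ n)).comp
      ((measurable_pi_apply i).comp (hU.measurable_picard k t))
  calc _ ≤ ∫⁻ ω, liminf (fun k =>
        ENNReal.ofReal ((1 + (picard U β₀ β₁ β₂ W k t ω i : ℝ)) ^ n)) atTop ∂P := by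
        refine lintegral_mono_ae ?_
        filter_upwards [ae_eventually_picard_eq (β₀ := β₀) hβ hW hC hU] with ω h
        refine le_liminf_of_le (by isBoundedDefault) ((h t i).mono fun k hk => ?_)
        rw [hk]
    _ ≤ liminf (fun k => ∫⁻ ω,
        ENNReal.ofReal ((1 + (picard U β₀ β₁ β₂ W k t ω i : ℝ)) ^ n) ∂P) atTop :=
        lintegral_liminf_le hmeas
    _ ≤ _ := by
        refine liminf_le_of_le (by isBoundedDefault) fun b hb => ?_
        obtain ⟨k, hk⟩ := hb.exists
        exact hk.trans (lintegral_one_add_picard_pow_le hβ hW hC hU n k t i)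

end Contraction

/-! ### The stationary solution -/

section Existence

lemma integrable_and_integral_le {Ω : Type*} [MeasurableSpace Ω] {P : Measure Ω} {f : Ω → ℝ}
    (hf : Measurable f) (h0 : ∀ ω, 0 ≤ f ω) {B : ℝ} (hB : 0 ≤ B)
    (h : ∫⁻ ω, ENNReal.ofReal (f ω) ∂P ≤ ENNReal.ofReal B) :
    Integrable f P ∧ ∫ ω, f ω ∂P ≤ B := by
  refine ⟨⟨hf.aestronglyMeasurable, ?_⟩, ?_⟩
  · rw [hasFiniteIntegral_iff_ofReal (Eventually.of_forall h0)]
    exact h.trans_lt ENNReal.ofReal_lt_top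
  · rw [integral_eq_lintegral_of_nonneg_ae (Eventually.of_forall h0) hf.aestronglyMeasurable]
    exact ENNReal.toReal_le_of_le_ofReal hB h

variable {Ω : Type*} {mΩ : MeasurableSpace Ω} {ι : Type} [Countable ι] {p : ℕ} {P : Measure Ω}
  [IsProbabilityMeasure P] {C : Measure (ι → ℝ)} {U : ℤ → ℕ → Ω → ι → ℝ} {β₀ : ℝ}
  {β₁ β₂ : Fin p → ℝ} {W : ι → ι → ℝ}

/-- Absolutely summable combinations of the stationary solution converge almost surely. -/
lemma ae_summable_mul_picardLimit (hβ : ∑ h, (|β₁ h| + |β₂ h|) < 1) (hW : IsWeightMatrix W)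
    (hC : IsCopula C) (hU : IsCopulaSample P C U) {w : ι → ℝ} (hw : Summable fun j => |w j|)
    (t : ℤ) :
    ∀ᵐ ω ∂P, Summable fun j => |w j| * (picardLimit U β₀ β₁ β₂ W t ω j : ℝ) := by
  set c := ∑ h, (|β₁ h| + |β₂ h|)
  have hmeas : ∀ j, Measurable fun ω =>
      ENNReal.ofReal (|w j| * (picardLimit U β₀ β₁ β₂ W t ω j : ℝ)) := fun j =>
    (measurable_of_countable fun k : ℕ => ENNReal.ofReal (|w j| * (k : ℝ))).comp
      ((measurable_pi_apply j).comp (hU.measurable_picardLimit t))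
  have hfin : ∫⁻ ω, ∑' j, ENNReal.ofReal (|w j| * (picardLimit U β₀ β₁ β₂ W t ω j : ℝ)) ∂P
      ≠ ∞ := by
    rw [lintegral_tsum fun j => (hmeas j).aemeasurable]
    refine ne_top_of_le_ne_top (b := ∑' j, ENNReal.ofReal |w j| *
      ENNReal.ofReal (countConst β₀ c 1)) ?_ (ENNReal.tsum_le_tsum fun j => ?_)
    · rw [ENNReal.tsum_mul_right]
      exact ENNReal.mul_ne_top hw.tsum_ofReal_ne_top ENNReal.ofReal_ne_top
    · simp_rw [ENNReal.ofReal_mul (abs_nonneg (w j))]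
      rw [lintegral_const_mul' _ _ ENNReal.ofReal_ne_top]
      gcongr
      refine le_trans (lintegral_mono fun ω => ENNReal.ofReal_le_ofReal ?_)
        (lintegral_one_add_picardLimit_pow_le hβ hW hC hU 1 t j)
      simp
  filter_upwards [ae_lt_top (Measurable.tsum hmeas) hfin] with ω h
  have := ENNReal.summable_toReal h.ne
  refine this.congr fun j => ?_
  rw [ENNReal.toReal_ofReal (by positivity)]

theorem isSolution_picardLimit (hβ : ∑ h, (|β₁ h| + |β₂ h|) < 1) (hW : IsWeightMatrix W)
    (hC : IsCopula C) (hU : IsCopulaSample P C U) :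
    IsSolution P U β₀ β₁ β₂ W (picardLimit U β₀ β₁ β₂ W) where
  measurable t := hU.measurable_picardLimit t
  indep_past t := by
    -- The limit is causal, so its past adds nothing to the noise before `t`.
    refine indep_of_indep_of_le_right (indep_noiseBefore hU t) (iSup₂_le fun s hs => ?_)
    refine sup_le ?_ (le_iSup₂_of_le s hs le_rfl)
    exact (measurable_picardLimit_noiseBefore hs).comap_le
  summable t := by
    refine ae_all_iff.2 fun i => ?_
    filter_upwards [ae_summable_mul_picardLimit hβ hW hC hU (hW i).1 t] with ω h
    refine Summable.of_norm_bounded h fun j => ?_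
    rw [norm_mul, Real.norm_eq_abs, Real.norm_of_nonneg (logCount_nonneg _)]
    gcongr
    exact logCount_le _
  eq t := ae_picardLimit_eq hβ hW hC hU t

theorem hasMomentBounds_picardLimit (hβ : ∑ h, (|β₁ h| + |β₂ h|) < 1) (hW : IsWeightMatrix W)
    (hC : IsCopula C) (hU : IsCopulaSample P C U) :
    HasMomentBounds P β₀ β₁ β₂ W (picardLimit U β₀ β₁ β₂ W)
      (fun r => countConst β₀ (∑ h, (|β₁ h| + |β₂ h|)) ⌈r⌉₊)
      (fun r => intensityConst β₀ (∑ h, (|β₁ h| + |β₂ h|)) ⌈r⌉₊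
        + (2 * 2 ^ ⌈r⌉₊)⁻¹ * countConst β₀ (∑ h, (|β₁ h| + |β₂ h|)) ⌈r⌉₊) := by
  intro r hr t i
  set c := ∑ h, (|β₁ h| + |β₂ h|)
  -- Real orders are rounded up to integers; this is harmless because `1 + Y ≥ 1` and `|ν| ≥ 0`.
  set n := ⌈r⌉₊
  have hrn : r ≤ n := Nat.le_ceil r
  have hB := one_le_countConst β₀ c n
  have hK := intensityConst_nonneg β₀ c n
  have hYm : Measurable fun ω => picardLimit U β₀ β₁ β₂ W t ω i :=
    (measurable_pi_apply i).comp (hU.measurable_picardLimit t)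
  have hνm : Measurable fun ω => logIntensity β₀ β₁ β₂ W (picardLimit U β₀ β₁ β₂ W) t ω i :=
    measurable_logIntensity (fun s _ => hU.measurable_picardLimit s) i
  constructor
  · refine integrable_and_integral_le ?_ (fun ω => by positivity) (by linarith) ?_
    · exact (measurable_of_countable fun k : ℕ => |(k : ℝ)| ^ r).comp hYm
    · refine le_trans (lintegral_mono fun ω => ENNReal.ofReal_le_ofReal ?_)
        (lintegral_one_add_picardLimit_pow_le hβ hW hC hU n t i)
      rw [Nat.abs_cast, ← Real.rpow_natCast]
      calc (picardLimit U β₀ β₁ β₂ W t ω i : ℝ) ^ r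
          ≤ (1 + (picardLimit U β₀ β₁ β₂ W t ω i : ℝ)) ^ r := by
            gcongr
            linarith
        _ ≤ _ := Real.rpow_le_rpow_of_exponent_le (by simp) hrn
  · refine integrable_and_integral_le (by fun_prop) (fun ω => (Real.exp_pos _).le)
      (by positivity) ?_
    refine le_trans (lintegral_mono fun ω => ENNReal.ofReal_le_ofReal ?_)
      (lintegral_exp_abs_logIntensity_le hβ hW (fun t => hU.measurable_picardLimit t)
        (by linarith) (fun t i => lintegral_one_add_picardLimit_pow_le hβ hW hC hU n t i) t i)
    gcongr

end Existence

/-! ### Stationarity -/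

section Stationarity

variable {Ω Ω' : Type*} {ι : Type} {p : ℕ} {β₀ : ℝ} {β₁ β₂ : Fin p → ℝ} {W : ι → ι → ℝ}

/-- The iterates at `ω` depend only on the noise path at `ω`. Allowing two sample spaces makes it
possible to compare with the canonical space of noise paths. -/
lemma picard_shift {U : ℤ → ℕ → Ω → ι → ℝ} {U' : ℤ → ℕ → Ω' → ι → ℝ} {ω : Ω} {ω' : Ω'} {s : ℤ}
    (h : ∀ t l, U t l ω = U' (t + s) l ω') (n : ℕ) (t : ℤ) :
    picard U β₀ β₁ β₂ W n t ω = picard U' β₀ β₁ β₂ W n (t + s) ω' := by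
  induction n generalizing t with
  | zero => rfl
  | succ n ih =>
    funext i
    have h1 : logIntensity β₀ β₁ β₂ W (picard U β₀ β₁ β₂ W n) t ω i
        = logIntensity β₀ β₁ β₂ W (picard U' β₀ β₁ β₂ W n) (t + s) ω' i := by
      unfold logIntensity
      simp_rw [ih, add_sub_right_comm]
    simp only [picard, copulaPoisson, h1, h]

lemma picardLimit_shift {U : ℤ → ℕ → Ω → ι → ℝ} {U' : ℤ → ℕ → Ω' → ι → ℝ} {ω : Ω} {ω' : Ω'}
    {s : ℤ} (h : ∀ t l, U t l ω = U' (t + s) l ω') (t : ℤ) :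
    picardLimit U β₀ β₁ β₂ W t ω = picardLimit U' β₀ β₁ β₂ W (t + s) ω' := by
  funext i
  simp only [picardLimit, picard_shift h]

lemma IsStrictlyStationary.comp [MeasurableSpace Ω] {P : Measure Ω} {E F : Type*}
    [MeasurableSpace E] [MeasurableSpace F] {X : ℤ → Ω → E} (hX : IsStrictlyStationary P X)
    {g : E → F} (hg : Measurable g) : IsStrictlyStationary P fun t ω => g (X t ω) := fun s =>
  (hX s).comp (u := fun (x : ℤ → E) (t : ℤ) => g (x t))
    (measurable_pi_lambda _ fun t => hg.comp (measurable_pi_apply t))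

lemma IsStrictlyStationary.measure_eq [MeasurableSpace Ω] {P : Measure Ω} {E : Type*}
    [MeasurableSpace E] {X : ℤ → Ω → E} (hX : IsStrictlyStationary P X) {S : Set E}
    (hS : MeasurableSet S) (t : ℤ) : P {ω | X t ω ∈ S} = P {ω | X 0 ω ∈ S} := by
  have h := ((hX t).comp (measurable_pi_apply (0 : ℤ))).measure_mem_eq hS
  simp only [Function.comp_def, zero_add] at h
  exact h

theorem isStrictlyStationary_picardLimit [Countable ι] [MeasurableSpace Ω] {P : Measure Ω}
    {C : Measure (ι → ℝ)} {U : ℤ → ℕ → Ω → ι → ℝ} (hU : IsCopulaSample P C U) :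
    IsStrictlyStationary P (picardLimit U β₀ β₁ β₂ W) := by
  intro s
  -- Coordinate noise on path space: it exhibits the solution as one measurable functional of the
  -- noise path, and shifting time only shifts the path, whose law is invariant.
  let V : ℤ → ℕ → (ℤ × ℕ → ι → ℝ) → ι → ℝ := fun t l u => u (t, l)
  have hV : Measurable fun (u : ℤ × ℕ → ι → ℝ) (t : ℤ) => picardLimit V β₀ β₁ β₂ W t u :=
    measurable_pi_lambda _ fun t => measurable_picardLimit fun r _ l => measurable_pi_apply (r, l)
  have hshift : IdentDistrib (fun ω (q : ℤ × ℕ) => U (q.1 + s) q.2 ω)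
      (fun ω (q : ℤ × ℕ) => U q.1 q.2 ω) P P := by
    refine IdentDistrib.pi (fun q => ?_) ?_ hU.indep
    · exact ⟨(hU.measurable _ _).aemeasurable, (hU.measurable _ _).aemeasurable, by
        rw [hU.law, hU.law]⟩
    · exact hU.indep.precomp (g := fun q : ℤ × ℕ => (q.1 + s, q.2)) fun a b h => by
        simp only [Prod.mk.injEq, add_left_inj] at h
        exact Prod.ext h.1 h.2
  have h1 : ∀ s, (fun ω (t : ℤ) => picardLimit U β₀ β₁ β₂ W (t + s) ω)
      = (fun (u : ℤ × ℕ → ι → ℝ) (t : ℤ) => picardLimit V β₀ β₁ β₂ W t u) ∘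
        fun ω (q : ℤ × ℕ) => U (q.1 + s) q.2 ω := by
    intro s
    funext ω t
    exact (picardLimit_shift (U := V) (U' := U) (ω := fun q : ℤ × ℕ => U (q.1 + s) q.2 ω)
      (fun _ _ => rfl) t).symm
  have h2 := h1 0
  simp only [add_zero] at h2
  rw [h1 s, h2]
  exact hshift.comp hV

theorem isStrictlyStationaryInf_picardLimit [MeasurableSpace Ω] {P : Measure Ω}
    [IsProbabilityMeasure P] {C : Measure (ℕ → ℝ)} {W : ℕ → ℕ → ℝ} {U : ℤ → ℕ → Ω → ℕ → ℝ}
    (hβ : ∑ h, (|β₁ h| + |β₂ h|) < 1) (hW : IsWeightMatrix W)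
    (hC : IsCopula C) (hU : IsCopulaSample P C U) :
    IsStrictlyStationaryInf P (picardLimit U β₀ β₁ β₂ W) := by
  intro w hw
  refine ⟨fun t ω => ∑' i, w i * (picardLimit U β₀ β₁ β₂ W t ω i : ℝ), fun t => ?_, ?_⟩
  · filter_upwards [ae_summable_mul_picardLimit hβ hW hC hU hw t] with ω h
    refine (Summable.of_norm_bounded h fun j => ?_).hasSum.tendsto_sum_nat
    rw [norm_mul, Real.norm_eq_abs, Real.norm_natCast]
  · refine (isStrictlyStationary_picardLimit hU).comp
      (g := fun y : ℕ → ℕ => ∑' i, w i * (y i : ℝ)) (Measurable.tsum fun i => ?_)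
    exact (measurable_of_countable fun k : ℕ => w i * (k : ℝ)).comp (measurable_pi_apply i)

end Stationarity

/-! ### Uniqueness -/

section Uniqueness

/-- Small combinations of the counts at any time are small in probability. -/
def SmallCombinations {Ω : Type*} [MeasurableSpace Ω] {ι : Type} (P : Measure Ω)
    (X : ℤ → Ω → ι → ℕ) : Prop :=
  ∀ η > (0 : ℝ≥0∞), ∀ δ > (0 : ℝ≥0∞), ∃ ε > (0 : ℝ≥0∞), ∀ (t : ℤ) (w : ι → ℝ≥0∞),
    ∑' j, w j ≤ ε → P {ω | δ < ∑' j, w j * (X t ω j : ℝ≥0∞)} ≤ η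

variable {Ω : Type*} {mΩ : MeasurableSpace Ω} {ι : Type} [Countable ι] {P : Measure Ω}

/-- A gliding hump argument: if all summable combinations of the counts are finite, with laws
that do not depend on the time, then small combinations are small in probability. -/
lemma smallCombinations_of_finite [IsFiniteMeasure P] {X : ℤ → Ω → ι → ℕ}
    (hX : ∀ t, Measurable (X t))
    (hfin : ∀ w : ι → ℝ≥0∞, ∑' j, w j ≠ ∞ → ∀ᵐ ω ∂P, ∑' j, w j * (X 0 ω j : ℝ≥0∞) ≠ ∞)
    (hlaw : ∀ w : ι → ℝ≥0∞, ∑' j, w j ≠ ∞ → ∀ (t : ℤ) (δ : ℝ≥0∞),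
      P {ω | δ < ∑' j, w j * (X t ω j : ℝ≥0∞)} = P {ω | δ < ∑' j, w j * (X 0 ω j : ℝ≥0∞)}) :
    SmallCombinations P X := by
  intro η hη δ hδ
  by_contra! hcon
  have hpos : ∀ k : ℕ, (0 : ℝ≥0∞) < 2⁻¹ ^ k := fun k =>
    ENNReal.pow_pos (ENNReal.inv_pos.2 ENNReal.ofNat_ne_top) k
  -- If the claim fails, there are weights of mass at most `2^(-k)` whose combinations exceed `δ`
  -- with probability above `η`. Their sum over `k` is again summable, so its combination is finite
  -- almost surely; hence the `k`-th combinations tend to 0, a contradiction.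
  choose t w hw hP using fun k : ℕ => hcon (2⁻¹ ^ k) (hpos k)
  have hgeo : ∑' k : ℕ, (2⁻¹ : ℝ≥0∞) ^ k ≠ ∞ := by
    rw [ENNReal.tsum_geometric]
    simp
  have hv : ∑' j, ∑' k, w k j ≠ ∞ := by
    rw [ENNReal.tsum_comm]
    exact ne_top_of_le_ne_top hgeo (ENNReal.tsum_le_tsum hw)
  have hP0 : ∀ k, η < P {ω | δ < ∑' j, w k j * (X 0 ω j : ℝ≥0∞)} := fun k => by
    rw [← hlaw (w k) (ne_top_of_le_ne_top (ENNReal.ne_top_of_tsum_ne_top hgeo k) (hw k)) (t k)]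
    exact hP k
  have hTm : ∀ k, Measurable fun ω => ∑' j, w k j * (X 0 ω j : ℝ≥0∞) := fun k =>
    Measurable.tsum fun j => (measurable_of_countable fun n : ℕ => w k j * (n : ℝ≥0∞)).comp
      ((measurable_pi_apply j).comp (hX 0))
  have hlim : Tendsto (fun k => P {ω | δ < ∑' j, w k j * (X 0 ω j : ℝ≥0∞)}) atTop
      (𝓝 (P ∅)) := by
    refine tendsto_measure_of_ae_tendsto_indicator_of_isFiniteMeasure atTop MeasurableSet.empty
      (fun k => measurableSet_lt measurable_const (hTm k)) ?_
    filter_upwards [hfin _ hv] with ω h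
    have h1 : ∑' k, ∑' j, w k j * (X 0 ω j : ℝ≥0∞) ≠ ∞ := by
      rw [ENNReal.tsum_comm]
      simpa only [ENNReal.tsum_mul_right] using h
    filter_upwards [(ENNReal.tendsto_atTop_zero_of_tsum_ne_top h1).eventually_lt_const hδ]
      with k hk
    simp only [Set.mem_empty_iff_false, iff_false, not_lt]
    exact hk.le
  rw [measure_empty] at hlim
  obtain ⟨k, hk⟩ := (hlim.eventually_lt_const hη).exists
  exact absurd hk (hP0 k).not_gt

lemma IsStrictlyStationary.smallCombinations [Finite ι] [IsFiniteMeasure P] {X : ℤ → Ω → ι → ℕ}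
    (hX : ∀ t, Measurable (X t)) (hs : IsStrictlyStationary P X) : SmallCombinations P X := by
  refine smallCombinations_of_finite hX (fun w hw => Eventually.of_forall fun ω => ?_)
    fun w _ t δ => ?_
  · cases nonempty_fintype ι
    rw [tsum_fintype]
    exact ENNReal.sum_ne_top.2 fun j _ =>
      ENNReal.mul_ne_top (ENNReal.ne_top_of_tsum_ne_top hw j) (ENNReal.natCast_ne_top _)
  · refine hs.measure_eq (S := {x : ι → ℕ | δ < ∑' j, w j * (x j : ℝ≥0∞)})
      (measurableSet_lt measurable_const (Measurable.tsum fun j => ?_)) t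
    exact (measurable_of_countable fun n : ℕ => w j * (n : ℝ≥0∞)).comp (measurable_pi_apply j)

/-- For nonnegative weights the limit in the definition of stationarity is the sum of the series in
`[0, ∞]`, which is therefore finite almost surely, with a law independent of time. -/
lemma IsStrictlyStationaryInf.smallCombinations [IsFiniteMeasure P] {X : ℤ → Ω → ℕ → ℕ}
    (hX : ∀ t, Measurable (X t)) (hs : IsStrictlyStationaryInf P X) : SmallCombinations P X := by
  have key : ∀ w : ℕ → ℝ≥0∞, ∑' j, w j ≠ ∞ → ∃ L : ℤ → Ω → ℝ, IsStrictlyStationary P L ∧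
      ∀ t, ∀ᵐ ω ∂P, ∑' j, w j * (X t ω j : ℝ≥0∞) = ENNReal.ofReal (L t ω) := by
    intro w hw
    have hwj := ENNReal.ne_top_of_tsum_ne_top hw
    obtain ⟨L, hL, hstat⟩ := hs (fun j => (w j).toReal)
      (by simpa only [abs_of_nonneg ENNReal.toReal_nonneg] using ENNReal.summable_toReal hw)
    refine ⟨L, hstat, fun t => ?_⟩
    filter_upwards [hL t] with ω h
    have hnn : ∀ j, 0 ≤ (w j).toReal * (X t ω j : ℝ) := fun j => by positivity
    have h1 := (hasSum_iff_tendsto_nat_of_nonneg hnn _).2 h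
    rw [← h1.tsum_eq, ENNReal.ofReal_tsum_of_nonneg hnn h1.summable]
    refine tsum_congr fun j => ?_
    rw [ENNReal.ofReal_mul ENNReal.toReal_nonneg, ENNReal.ofReal_toReal (hwj j),
      ENNReal.ofReal_natCast]
  refine smallCombinations_of_finite hX (fun w hw => ?_) fun w hw t δ => ?_
  · obtain ⟨L, -, hL⟩ := key w hw
    filter_upwards [hL 0] with ω h
    rw [h]
    exact ENNReal.ofReal_ne_top
  · obtain ⟨L, hstat, hL⟩ := key w hw
    have h1 : ∀ t, P {ω | δ < ∑' j, w j * (X t ω j : ℝ≥0∞)}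
        = P {ω | L t ω ∈ {x : ℝ | δ < ENNReal.ofReal x}} := fun t => by
      refine measure_congr ?_
      filter_upwards [hL t] with ω h
      refine propext ?_
      change δ < _ ↔ δ < _
      rw [h]
    rw [h1 t, h1 0]
    exact hstat.measure_eq (measurableSet_lt measurable_const ENNReal.measurable_ofReal) t

/-- Iterating a linear recursive inequality of order `p` back to time `s`: the value at time `t` is
dominated by a combination of the values at times `s, s - 1, …, s - p + 1`, with weights that
decay exponentially in `t - s` and do not depend on the function `d`. -/
lemma exists_backward_weights {ι : Type} {p : ℕ} {a : ι → Fin p × ι → ℝ≥0∞} {ρ : ℝ} (hρ0 : 0 < ρ)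
    (hρ1 : ρ ≤ 1) (ha : ∀ i, ∑' k, a i k ≤ ENNReal.ofReal (ρ ^ p)) (s : ℤ) (n : ℕ) (t : ℤ)
    (htn : t ≤ s + n) (hst : s - p < t) (i : ι) :
    ∃ α : Fin p × ι → ℝ≥0∞, ∑' k, α k ≤ ENNReal.ofReal (ρ ^ (t - s)) ∧
      ∀ d : ℤ → ι → ℝ≥0∞,
        (∀ r > s, ∀ i, d r i ≤ ∑' k : Fin p × ι, a i k * d (r - ((k.1 : ℕ) + 1)) k.2) →
        d t i ≤ ∑' k : Fin p × ι, α k * d (s - (k.1 : ℕ)) k.2 := by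
  classical
  induction n generalizing t i with
  | zero =>
    have hlt : (s - t).toNat < p := by omega
    -- For `s - p < t ≤ s` the value is itself one of those kept, so a point mass suffices; `ρ^(t-s)
    -- ≥ 1` here.
    refine ⟨Pi.single (⟨(s - t).toNat, hlt⟩, i) 1, ?_, fun d _ => ?_⟩
    · rw [tsum_pi_single, ← ENNReal.ofReal_one]
      exact ENNReal.ofReal_le_ofReal (one_le_zpow_of_nonpos₀ hρ0 hρ1 (by omega))
    · refine le_trans (le_of_eq ?_) (ENNReal.le_tsum (⟨(s - t).toNat, hlt⟩, i))
      rw [Pi.single_eq_same, one_mul]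
      congr 1
      simp only
      omega
  | succ n ih =>
    by_cases hle : t ≤ s + n
    · exact ih t hle hst i
    have hts : t = s + n + 1 := by push_cast at htn; omega
    choose α hα hd using fun k : Fin p × ι =>
      ih (t - ((k.1 : ℕ) + 1)) (by omega) (by have := k.1.2; omega) k.2
    refine ⟨fun k' => ∑' k, a i k * α k k', ?_, fun d hrec => ?_⟩
    · rw [ENNReal.tsum_comm]
      calc ∑' k, ∑' k', a i k * α k k'
          ≤ ∑' k, a i k * ENNReal.ofReal (ρ ^ (t - s - p)) := by
            refine ENNReal.tsum_le_tsum fun k => ?_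
            rw [ENNReal.tsum_mul_left]
            gcongr
            refine (hα k).trans (ENNReal.ofReal_le_ofReal ?_)
            -- One use of the recursion goes back at most `p` time units, which is why its mass is
            -- measured against `ρ^p` and not `ρ`.
            exact zpow_le_zpow_right_of_le_one₀ hρ0 hρ1 (by have := k.1.2; omega)
        _ ≤ ENNReal.ofReal (ρ ^ p) * ENNReal.ofReal (ρ ^ (t - s - p)) := by
            rw [ENNReal.tsum_mul_right]
            gcongr
            exact ha i
        _ = ENNReal.ofReal (ρ ^ (t - s)) := by
            rw [← ENNReal.ofReal_mul (by positivity), ← zpow_natCast, ← zpow_add₀ hρ0.ne']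
            congr 2
            ring
    · calc d t i ≤ ∑' k : Fin p × ι, a i k * d (t - ((k.1 : ℕ) + 1)) k.2 :=
            hrec t (by omega) i
        _ ≤ ∑' k : Fin p × ι, a i k * ∑' k' : Fin p × ι, α k k' * d (s - (k'.1 : ℕ)) k'.2 := by
            gcongr with k
            exact hd k d hrec
        _ = ∑' k : Fin p × ι, ∑' k' : Fin p × ι, a i k * (α k k' * d (s - (k'.1 : ℕ)) k'.2) := by
            simp_rw [ENNReal.tsum_mul_left]
        _ = _ := by
            rw [ENNReal.tsum_comm]
            refine tsum_congr fun k' => ?_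
            rw [← ENNReal.tsum_mul_right]
            exact tsum_congr fun k => (mul_assoc _ _ _).symm

lemma enorm_logCount_sub_le (m n : ℕ) :
    ‖logCount m - logCount n‖ₑ ≤ (m : ℝ≥0∞) + (n : ℝ≥0∞) := by
  have h : ∀ k : ℕ, ‖logCount k‖ₑ ≤ (k : ℝ≥0∞) := fun k => by
    rw [Real.enorm_of_nonneg (logCount_nonneg k), ← ENNReal.ofReal_natCast]
    exact ENNReal.ofReal_le_ofReal (logCount_le k)
  exact (enorm_sub_le).trans (add_le_add (h m) (h n))

lemma measurable_combination {Ω : Type*} {m : MeasurableSpace Ω} {p : ℕ} {X X' : ℤ → Ω → ι → ℕ}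
    {s : ℤ} (α : Fin p × ι → ℝ≥0∞) (hX : ∀ g : Fin p, Measurable (X (s - (g : ℕ))))
    (hX' : ∀ g : Fin p, Measurable (X' (s - (g : ℕ)))) :
    Measurable fun ω => ∑' k : Fin p × ι, α k * ‖logCount (X (s - (k.1 : ℕ)) ω k.2)
      - logCount (X' (s - (k.1 : ℕ)) ω k.2)‖ₑ :=
  Measurable.tsum fun k => (measurable_enorm_logCount_sub
    ((measurable_pi_apply k.2).comp (hX k.1)) ((measurable_pi_apply k.2).comp (hX' k.1))).const_mul _

/-- Combinations over several lags of the distance of two processes are small in probability. -/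
lemma measure_lt_combination_le {ι : Type} {p : ℕ} {X X' : ℤ → Ω → ι → ℕ} (h : SmallCombinations P X)
    (h' : SmallCombinations P X') {η : ℝ≥0∞} (hη : 0 < η) :
    ∃ ε > (0 : ℝ≥0∞), ∀ (s : ℤ) (α : Fin p × ι → ℝ≥0∞), ∑' k, α k ≤ ε →
      P {ω | η < ∑' k : Fin p × ι, α k * ‖logCount (X (s - (k.1 : ℕ)) ω k.2)
        - logCount (X' (s - (k.1 : ℕ)) ω k.2)‖ₑ} ≤ η := by
  -- There are `2 * p` errors to share, from `p` lags and two processes; the `+ 1` keeps the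
  -- denominator nonzero for `p = 0`.
  set η₀ := η / (2 * p + 1 : ℕ) with hη₀
  have hη₀pos : 0 < η₀ := ENNReal.div_pos hη.ne' (ENNReal.natCast_ne_top _)
  have hmul : (2 * p : ℕ) * η₀ ≤ η := by
    calc (2 * p : ℕ) * η₀ ≤ (2 * p + 1 : ℕ) * η₀ := by gcongr; omega
      _ ≤ η := ENNReal.mul_div_le
  obtain ⟨ε, hε, hw⟩ := h η₀ hη₀pos η₀ hη₀pos
  obtain ⟨ε', hε', hw'⟩ := h' η₀ hη₀pos η₀ hη₀pos
  refine ⟨min ε ε', lt_min hε hε', fun s α hα => ?_⟩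
  have hrow : ∀ g : Fin p, ∑' j, α (g, j) ≤ min ε ε' := fun g => by
    refine le_trans ?_ hα
    rw [ENNReal.tsum_prod']
    exact ENNReal.le_tsum (f := fun g => ∑' j, α (g, j)) g
  calc _ ≤ P (⋃ g : Fin p, ({ω | η₀ < ∑' j, α (g, j) * (X (s - (g : ℕ)) ω j : ℝ≥0∞)} ∪
        {ω | η₀ < ∑' j, α (g, j) * (X' (s - (g : ℕ)) ω j : ℝ≥0∞)})) := by
        refine measure_mono fun ω hω => ?_
        by_contra hcon
        simp only [Set.mem_iUnion, Set.mem_union, Set.mem_ofPred_eq, not_exists, not_or,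
          not_lt] at hcon
        refine absurd (show η < _ from hω) (not_lt.2 ?_)
        calc ∑' k : Fin p × ι, α k * ‖logCount (X (s - (k.1 : ℕ)) ω k.2)
              - logCount (X' (s - (k.1 : ℕ)) ω k.2)‖ₑ
            ≤ ∑' k : Fin p × ι, (α k * (X (s - (k.1 : ℕ)) ω k.2 : ℝ≥0∞)
              + α k * (X' (s - (k.1 : ℕ)) ω k.2 : ℝ≥0∞)) := by
              refine ENNReal.tsum_le_tsum fun k => ?_
              rw [← mul_add]
              gcongr
              exact enorm_logCount_sub_le _ _
          _ = ∑ g : Fin p, (∑' j, α (g, j) * (X (s - (g : ℕ)) ω j : ℝ≥0∞)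
              + ∑' j, α (g, j) * (X' (s - (g : ℕ)) ω j : ℝ≥0∞)) := by
              rw [ENNReal.tsum_prod', tsum_fintype]
              exact Finset.sum_congr rfl fun g _ => ENNReal.tsum_add
          _ ≤ ∑ _g : Fin p, (η₀ + η₀) :=
              Finset.sum_le_sum fun g _ => add_le_add (hcon g).1 (hcon g).2
          _ = (2 * p : ℕ) * η₀ := by
              rw [Finset.sum_const, Finset.card_univ, Fintype.card_fin, nsmul_eq_mul]
              push_cast
              ring
          _ ≤ η := hmul
    _ ≤ ∑ g : Fin p, (η₀ + η₀) := by
        refine (measure_iUnion_fintype_le P _).trans (Finset.sum_le_sum fun g _ => ?_)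
        refine (measure_union_le _ _).trans (add_le_add ?_ ?_)
        · exact hw _ _ ((hrow g).trans (min_le_left _ _))
        · exact hw' _ _ ((hrow g).trans (min_le_right _ _))
    _ = (2 * p : ℕ) * η₀ := by
        rw [Finset.sum_const, Finset.card_univ, Fintype.card_fin, nsmul_eq_mul]
        push_cast
        ring
    _ ≤ η := hmul

/-- Bernoulli's inequality for `ρ = 1 - (1 - c) / (p + 2)`; the 2 keeps `ρ` positive even if `p = 0`
and `c = 0`. -/
lemma exists_decay_rate {c : ℝ} (hc0 : 0 ≤ c) (hc : c < 1) (p : ℕ) :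
    ∃ ρ : ℝ, 0 < ρ ∧ ρ < 1 ∧ c ≤ ρ ^ p := by
  refine ⟨1 - (1 - c) / (p + 2), ?_, ?_, ?_⟩
  · rw [sub_pos, div_lt_one (by positivity)]
    have : (0 : ℝ) ≤ p := by positivity
    linarith
  · have : 0 < (1 - c) / ((p : ℝ) + 2) := div_pos (by linarith) (by positivity)
    linarith
  · have h1 : (1 - c) / ((p : ℝ) + 2) ≤ 1 := by
      rw [div_le_one (by positivity)]
      have : (0 : ℝ) ≤ p := by positivity
      linarith
    have h2 := one_add_mul_le_pow (a := -((1 - c) / ((p : ℝ) + 2))) (by linarith) p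
    rw [← sub_eq_add_neg] at h2
    refine le_trans ?_ h2
    have h3 : (p : ℝ) * ((1 - c) / (p + 2)) ≤ 1 - c := by
      rw [← mul_div_assoc, div_le_iff₀ (by positivity)]
      nlinarith [(by positivity : (0 : ℝ) ≤ p)]
    linarith

variable [IsProbabilityMeasure P] {p : ℕ} {C : Measure (ι → ℝ)} {U : ℤ → ℕ → Ω → ι → ℝ} {β₀ : ℝ}
  {β₁ β₂ : Fin p → ℝ} {W : ι → ι → ℝ}

/-- A solution whose small combinations are small in probability is the limit of the Picard
iterates. -/
theorem IsSolution.ae_eq_picardLimit (hβ : ∑ h, (|β₁ h| + |β₂ h|) < 1) (hW : IsWeightMatrix W)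
    (hC : IsCopula C) (hU : IsCopulaSample P C U) {Y : ℤ → Ω → ι → ℕ}
    (hY : IsSolution P U β₀ β₁ β₂ W Y) (hYs : SmallCombinations P Y)
    (hs : SmallCombinations P (picardLimit U β₀ β₁ β₂ W)) :
    ∀ᵐ ω ∂P, ∀ t i, Y t ω i = picardLimit U β₀ β₁ β₂ W t ω i := by
  refine ae_all_iff.2 fun t => ae_all_iff.2 fun i => ?_
  set X := picardLimit U β₀ β₁ β₂ W with hX
  have hXsol : IsSolution P U β₀ β₁ β₂ W X := isSolution_picardLimit hβ hW hC hU
  obtain ⟨ρ, hρ0, hρ1, hρ⟩ := exists_decay_rate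
    (Finset.sum_nonneg fun h _ => by positivity : 0 ≤ ∑ h, (|β₁ h| + |β₂ h|)) hβ p
  have hpast : ∀ r, past U Y r ≤ mΩ := fun r =>
    iSup₂_le fun q _ => sup_le (hY.measurable q).comap_le (noiseAt_le hU q)
  have hYpast : ∀ {q r : ℤ}, q < r → Measurable[past U Y r] (Y q) := fun {q r} h =>
    measurable_iff_comap_le.2 (le_iSup₂_of_le q h le_sup_left)
  -- The past of `Y` contains the past noise, hence also the past of the Picard limit, so one
  -- σ-algebra serves to compare both solutions.
  have hXpast : ∀ {q r : ℤ}, q < r → Measurable[past U Y r] (X q) := fun {q r} h =>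
    measurable_picardLimit fun q' hq' l => (measurable_noiseAt U q' l).mono
      (le_iSup₂_of_le q' (hq'.trans_lt h) le_sup_right) le_rfl
  have hpast_mono : ∀ {q r : ℤ}, q ≤ r → past U Y q ≤ past U Y r := fun {q r} h =>
    iSup₂_le fun q' hq' => le_iSup₂_of_le q' (hq'.trans_le h) le_rfl
  have hDm : ∀ (r : ℤ) (j : ι), Measurable fun ω => ‖logCount (Y r ω j) - logCount (X r ω j)‖ₑ :=
    fun r j => measurable_enorm_logCount_sub ((measurable_pi_apply j).comp (hY.measurable r))
      ((measurable_pi_apply j).comp (hXsol.measurable r))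
  have hsmall : ∀ η : ℝ≥0∞, 0 < η →
      ∫⁻ ω, min ‖logCount (Y t ω i) - logCount (X t ω i)‖ₑ 1 ∂P ≤ η + η := by
    intro η hη
    obtain ⟨ε, hε, hsm⟩ := measure_lt_combination_le (p := p) hYs hs hη
    have hρlim : Tendsto (fun n : ℕ => ENNReal.ofReal (ρ ^ n)) atTop (𝓝 0) := by
      simpa using ENNReal.tendsto_ofReal (tendsto_pow_atTop_nhds_zero_of_lt_one hρ0.le hρ1)
    -- The requirement `n ≥ 1` ensures `s - p < t` also when `p = 0`.
    obtain ⟨n, hn, hn1⟩ := ((hρlim.eventually_lt_const hε).and (eventually_ge_atTop 1)).exists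
    set s := t - n with hsdef
    obtain ⟨α, hα, hrec⟩ := exists_backward_weights (p := p)
      (a := fun i k => coef β₁ β₂ W k.1 i k.2) hρ0 hρ1.le
      (fun i => by
        rw [ENNReal.tsum_prod', tsum_fintype]
        exact (sum_tsum_coef_le hW i).trans (ENNReal.ofReal_le_ofReal hρ)) s n t
      (by omega) (by omega) i
    have hts : t - s = n := by omega
    rw [hts, zpow_natCast] at hα
    set Z : Ω → ℝ≥0∞ := fun ω => ∑' k : Fin p × ι, α k * ‖logCount (Y (s - (k.1 : ℕ)) ω k.2)
        - logCount (X (s - (k.1 : ℕ)) ω k.2)‖ₑ with hZ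
    have hZm : Measurable[past U Y (s + 1)] Z :=
      measurable_combination α (fun g => hYpast (by omega)) fun g => hXpast (by omega)
    -- Truncation replaces the missing moments of `Y`. As `A` depends on `α`, the weights had to be
    -- found before the function `d`, which involves `A`; and `A` lies in the past of every `r > s`,
    -- so the contraction holds on it.
    set A : Set Ω := {ω | Z ω ≤ η} with hA
    have hAm : MeasurableSet[past U Y (s + 1)] A :=
      hZm measurableSet_Iic
    have hAm' : MeasurableSet A := hpast _ _ hAm
    have hstep := hrec (fun r j => ∫⁻ ω in A, ‖logCount (Y r ω j) - logCount (X r ω j)‖ₑ ∂P) (by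
      intro r hr j
      have h1 := setLIntegral_step_le (β₀ := β₀) (β₁ := β₁) (β₂ := β₂) (W := W) hC hU (hpast r)
        (hY.indep_past r) (fun q hq => hYpast hq) (fun q hq => hXpast hq)
        (hpast_mono (by omega : s + 1 ≤ r) _ hAm) j
      rw [ENNReal.tsum_prod', tsum_fintype]
      refine le_trans (le_of_eq (lintegral_congr_ae (ae_restrict_of_ae ?_))) h1
      filter_upwards [hY.eq r, hXsol.eq r] with ω e1 e2
      rw [← e1 j, ← e2 j])
    have hAZ : ∫⁻ ω in A, ‖logCount (Y t ω i) - logCount (X t ω i)‖ₑ ∂P ≤ η := by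
      refine hstep.trans ?_
      calc _ = ∫⁻ ω in A, Z ω ∂P := by
            rw [lintegral_tsum fun k => ((hDm _ _).const_mul _).aemeasurable]
            exact tsum_congr fun k => (lintegral_const_mul _ (hDm _ _)).symm
        _ ≤ ∫⁻ _ω in A, η ∂P := setLIntegral_mono measurable_const fun ω hω => hω
        _ ≤ η := by
            rw [setLIntegral_const]
            exact mul_le_of_le_one_right' prob_le_one
    rw [← lintegral_add_compl _ hAm']
    refine add_le_add ((lintegral_mono fun ω => min_le_left _ _).trans hAZ) ?_
    calc ∫⁻ ω in Aᶜ, min ‖logCount (Y t ω i) - logCount (X t ω i)‖ₑ 1 ∂P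
        ≤ ∫⁻ _ω in Aᶜ, 1 ∂P := lintegral_mono fun ω => min_le_right _ _
      _ = P {ω | η < Z ω} := by
          rw [setLIntegral_one]
          congr 1
          ext ω
          simp [hA]
      _ ≤ η := hsm s α (hα.trans hn.le)
  have hzero : ∫⁻ ω, min ‖logCount (Y t ω i) - logCount (X t ω i)‖ₑ 1 ∂P = 0 := by
    by_contra hne
    have hpos := pos_iff_ne_zero.2 hne
    have hlt : ∫⁻ ω, min ‖logCount (Y t ω i) - logCount (X t ω i)‖ₑ 1 ∂P ≠ ∞ := by
      refine ne_top_of_le_ne_top ENNReal.one_ne_top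
        ((lintegral_mono fun ω => min_le_right _ _).trans ?_)
      simp
    -- With `η` a quarter of the integral, the bound `η + η` is half of it.
    have h1 := hsmall _ (ENNReal.div_pos (ENNReal.half_pos hne).ne' (ENNReal.ofNat_ne_top (n := 2)))
    rw [ENNReal.add_halves] at h1
    exact absurd h1 (ENNReal.half_lt_self hne hlt).not_ge
  rw [lintegral_eq_zero_iff ((hDm t i).min measurable_const)] at hzero
  filter_upwards [hzero] with ω h
  refine logCount_injective (sub_eq_zero.1 ?_)
  have h2 : min ‖logCount (Y t ω i) - logCount (X t ω i)‖ₑ 1 = 0 := h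
  rcases min_eq_iff.1 h2 with h3 | h3
  · simpa using h3.1
  · exact absurd h3.1 one_ne_zero

end Uniqueness

end PNAR

/-- The first conjunct is the model with `N` nodes, the second one the model of infinite dimension,
with nodes `0, 1, 2, …`; the constants `C r`, `D r` depend neither on `N` nor on the network, the
copula or the probability space. -/
theorem theorem2p2 (p : ℕ) (β₀ : ℝ) (β₁ β₂ : Fin p → ℝ)
    (hβ : ∑ h, (|β₁ h| + |β₂ h|) < 1) :
    ∃ C D : ℝ → ℝ,
      (∀ (Ω : Type*) [MeasurableSpace Ω] (P : Measure Ω) [IsProbabilityMeasure P]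
        (N : ℕ) (W : Fin N → Fin N → ℝ) (_ : PNAR.IsWeightMatrix W)
        (cop : Measure (Fin N → ℝ)) (_ : PNAR.IsCopula cop)
        (U : ℤ → ℕ → Ω → Fin N → ℝ) (_ : PNAR.IsCopulaSample P cop U),
        ∃ Y : ℤ → Ω → Fin N → ℕ,
          PNAR.IsSolution P U β₀ β₁ β₂ W Y ∧
          PNAR.IsStrictlyStationary P Y ∧
          PNAR.HasMomentBounds P β₀ β₁ β₂ W Y C D ∧
          ∀ Y' : ℤ → Ω → Fin N → ℕ,
            PNAR.IsSolution P U β₀ β₁ β₂ W Y' → PNAR.IsStrictlyStationary P Y' →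
              ∀ᵐ ω ∂P, ∀ t i, Y' t ω i = Y t ω i) ∧
      (∀ (Ω : Type*) [MeasurableSpace Ω] (P : Measure Ω) [IsProbabilityMeasure P]
        (W : ℕ → ℕ → ℝ) (_ : PNAR.IsWeightMatrix W)
        (cop : Measure (ℕ → ℝ)) (_ : PNAR.IsCopula cop)
        (U : ℤ → ℕ → Ω → ℕ → ℝ) (_ : PNAR.IsCopulaSample P cop U),
        ∃ Y : ℤ → Ω → ℕ → ℕ,
          PNAR.IsSolution P U β₀ β₁ β₂ W Y ∧
          PNAR.IsStrictlyStationaryInf P Y ∧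
          PNAR.HasMomentBounds P β₀ β₁ β₂ W Y C D ∧
          ∀ Y' : ℤ → Ω → ℕ → ℕ,
            PNAR.IsSolution P U β₀ β₁ β₂ W Y' → PNAR.IsStrictlyStationaryInf P Y' →
              ∀ᵐ ω ∂P, ∀ t i, Y' t ω i = Y t ω i) := by
  refine ⟨fun r => PNAR.countConst β₀ (∑ h, (|β₁ h| + |β₂ h|)) ⌈r⌉₊,
    fun r => PNAR.intensityConst β₀ (∑ h, (|β₁ h| + |β₂ h|)) ⌈r⌉₊
      + (2 * 2 ^ ⌈r⌉₊)⁻¹ * PNAR.countConst β₀ (∑ h, (|β₁ h| + |β₂ h|)) ⌈r⌉₊,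
    fun Ω _ P _ N W hW cop hC U hU => ?_, fun Ω _ P _ W hW cop hC U hU => ?_⟩
  · have hstat := PNAR.isStrictlyStationary_picardLimit (β₀ := β₀) (β₁ := β₁) (β₂ := β₂)
      (W := W) hU
    refine ⟨PNAR.picardLimit U β₀ β₁ β₂ W, PNAR.isSolution_picardLimit hβ hW hC hU, hstat,
      PNAR.hasMomentBounds_picardLimit hβ hW hC hU, fun Y' hY' hs => ?_⟩
    exact hY'.ae_eq_picardLimit hβ hW hC hU (hs.smallCombinations hY'.measurable)
      (hstat.smallCombinations fun t => hU.measurable_picardLimit t)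
  · have hstat := PNAR.isStrictlyStationaryInf_picardLimit (β₀ := β₀) hβ hW hC hU
    refine ⟨PNAR.picardLimit U β₀ β₁ β₂ W, PNAR.isSolution_picardLimit hβ hW hC hU, hstat,
      PNAR.hasMomentBounds_picardLimit hβ hW hC hU, fun Y' hY' hs => ?_⟩
    exact hY'.ae_eq_picardLimit hβ hW hC hU (hs.smallCombinations hY'.measurable)
      (hstat.smallCombinations fun t => hU.measurable_picardLimit t)

end
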